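/- Let $1<p<\infty$, let $\ell_p$ be the complex Banach space of $p$-summable sequences with canonical unit vectors $e_1,e_2,\dots$, and let $B_{\ell_p}$ be its open unit ball. Let $\mathcal{A}_u(B_{\ell_p})$ be the Banach algebra of uniformly continuous holomorphic functions $f:B_{\ell_p}\to\mathbb{C}$ with the supremum norm, and let $\mathcal{M}$ be its spectrum, that is, the set of nonzero multiplicative continuous linear functionals on $\mathcal{A}_u(B_{\ell_p})$, with the $w^*$-topology. For $\|x\|\le 1$ let $\delta_x\in\mathcal{M}$ be the evaluation at $x$ (of the continuous extension of $f$ to the closed ball). For $\varphi\in\mathcal{M}$ the Gleason part of $\varphi$ is $\mathcal{GP}(\varphi)=\{\psi\in\mathcal{M}:\ \|\varphi-\psi\|<2\}$, where $\|\cdot\|$ is the norm of the dual of $\mathcal{A}_u(B_{\ell_p})$. The corona is the set of all elements of $\mathcal{M}$ that do not lie in $\overline{\{\delta_x: x\in B_{\ell_p}\}}^{w^*}$. Let $z\in B_{\ell_p}$, let $s=(1-\|z\|^p)^{1/p}$, and for $n\in\mathbb{N}$ let $\pi_n(z)=(z(1),\dots,z(n),0,0,\dots)$. If $\varphi\in\mathcal{M}$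 is a $w^*$-accumulation point of the sequence $(\delta_{\pi_n(z)+s e_{n+1}})_{n\in\mathbb{N}}$, then $$\mathcal{GP}(\varphi)\cap\overline{\{\delta_x: x\in B_{\ell_p}\}}^{w^*}=\{\varphi\}.$$ Consequently, if the corona is empty, then $\mathcal{GP}(\varphi)=\{\varphi\}$. -/

import Mathlib

open Filter Topology Metric WeakDual
open scoped ENNReal BoundedContinuousFunction

namespace BallAlgebra

noncomputable section

section General

variable (X : Type*) [NormedAddCommGroup X] [NormedSpace ℂ X]

/-- A function on the open unit ball of `X` is holomorphic if near each point of the ball it is the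
sum of a power series (with continuous homogeneous polynomials as terms). -/
def IsHolomorphic {X : Type*} [NormedAddCommGroup X] [NormedSpace ℂ X]
    (f : ball (0 : X) 1 → ℂ) : Prop :=
  ∃ F : X → ℂ, AnalyticOnNhd ℂ F (ball 0 1) ∧ ∀ x : ball (0 : X) 1, F x = f x

/-- The algebra `𝒜ᵤ(B_X)` of uniformly continuous holomorphic functions on the open unit ball, with
the supremum norm. Uniformly continuous functions on the ball are automatically bounded, see
`exists_Au_eq`. -/
def Au : Subalgebra ℂ (ball (0 : X) 1 →ᵇ ℂ) where
  carrier := {f | UniformContinuous f ∧ IsHolomorphic f}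
  mul_mem' := by
    rintro f g ⟨hf, F, hF, hFf⟩ ⟨hg, G, hG, hGg⟩
    refine ⟨?_, F * G, hF.mul hG, fun x => by simp [hFf, hGg]⟩
    rw [Metric.uniformContinuous_iff] at hf hg ⊢
    intro ε hε
    obtain ⟨C, hC⟩ : ∃ C : ℝ, C = ‖f‖ + ‖g‖ + 1 := ⟨_, rfl⟩
    have hC0 : 0 < C := by rw [hC]; positivity
    obtain ⟨d₁, hd₁, h₁⟩ := hf (ε / (2 * C)) (by positivity)
    obtain ⟨d₂, hd₂, h₂⟩ := hg (ε / (2 * C)) (by positivity)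
    refine ⟨min d₁ d₂, lt_min hd₁ hd₂, fun {a b} hab => ?_⟩
    have e₁ := h₁ (hab.trans_le (min_le_left _ _))
    have e₂ := h₂ (hab.trans_le (min_le_right _ _))
    rw [dist_eq_norm] at e₁ e₂ ⊢
    have b₁ : ‖f a‖ ≤ C := (f.norm_coe_le_norm a).trans (by
      rw [hC]; linarith [norm_nonneg g])
    have b₂ : ‖g b‖ ≤ C := (g.norm_coe_le_norm b).trans (by
      rw [hC]; linarith [norm_nonneg f])
    have hsplit : (f * g) a - (f * g) b = f a * (g a - g b) + (f a - f b) * g b := by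
      simp only [BoundedContinuousFunction.coe_mul, Pi.mul_apply]; ring
    calc ‖(f * g) a - (f * g) b‖ ≤ ‖f a‖ * ‖g a - g b‖ + ‖f a - f b‖ * ‖g b‖ := by
          rw [hsplit, ← norm_mul, ← norm_mul]; exact norm_add_le _ _
      _ ≤ C * ‖g a - g b‖ + ‖f a - f b‖ * C := by gcongr
      _ < C * (ε / (2 * C)) + ε / (2 * C) * C := by gcongr
      _ = ε := by field_simp; ring
  add_mem' := by
    rintro f g ⟨hf, F, hF, hFf⟩ ⟨hg, G, hG, hGg⟩
    exact ⟨hf.add hg, F + G, hF.add hG, fun x => by simp [hFf, hGg]⟩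
  algebraMap_mem' := fun c =>
    ⟨uniformContinuous_const, fun _ => c, analyticOnNhd_const, fun _ => rfl⟩

variable {X}

/-- Every uniformly continuous holomorphic function on the ball belongs to `𝒜ᵤ(B_X)`. -/
theorem exists_Au_eq (f : ball (0 : X) 1 → ℂ) (hf : UniformContinuous f) (hol : IsHolomorphic f) :
    ∃ g : Au X, ∀ x, (g : ball (0 : X) 1 →ᵇ ℂ) x = f x := by
  obtain ⟨d, hd, h⟩ := Metric.uniformContinuous_iff.1 hf 1 one_pos
  obtain ⟨N, hN⟩ := exists_nat_gt (1 / d)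
  have hN0 : (0 : ℝ) < N := (by positivity : (0 : ℝ) < 1 / d).trans hN
  have hmem : ∀ (x : ball (0 : X) 1) (t : ℝ), 0 ≤ t → t ≤ 1 → (t : ℂ) • (x : X) ∈ ball (0 : X) 1 := by
    intro x t h0 h1
    have hx := mem_ball_zero_iff.1 x.2
    rw [mem_ball_zero_iff, norm_smul, Complex.norm_real, Real.norm_of_nonneg h0]
    nlinarith [norm_nonneg (x : X)]
  have key : ∀ (x : ball (0 : X) 1) (k : ℕ) (hk : k ≤ N),
      ‖f ⟨(((k : ℝ) / N : ℝ) : ℂ) • (x : X), hmem x _ (by positivity)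
        ((div_le_one hN0).2 (by exact_mod_cast hk))⟩ - f ⟨0, by simp⟩‖ ≤ k := by
    intro x k
    induction k with
    | zero => intro hk; simp
    | succ k ih =>
      intro hk
      have h1 := ih (by omega)
      have h2 := @h ⟨((((k + 1 : ℕ) : ℝ) / N : ℝ) : ℂ) • (x : X), hmem x _ (by positivity)
        ((div_le_one hN0).2 (by exact_mod_cast hk))⟩
        ⟨(((k : ℝ) / N : ℝ) : ℂ) • (x : X), hmem x _ (by positivity)
        ((div_le_one hN0).2 (by exact_mod_cast (by omega : k ≤ N)))⟩ (by
          rw [Subtype.dist_eq, dist_eq_norm, ← sub_smul, norm_smul, ← Complex.ofReal_sub,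
            Complex.norm_real]
          have hx := mem_ball_zero_iff.1 x.2
          have : ((k + 1 : ℕ) : ℝ) / N - (k : ℝ) / N = 1 / N := by push_cast; ring
          rw [this, Real.norm_of_nonneg (by positivity)]
          have h3 : 1 / (N : ℝ) < d := by
            rw [div_lt_iff₀ hd] at hN
            rw [div_lt_iff₀ hN0]; linarith
          have h4 : 0 < 1 / (N : ℝ) := by positivity
          nlinarith [norm_nonneg (x : X)])
      rw [dist_eq_norm] at h2
      push_cast at h2 h1 ⊢
      have h3 := norm_add_le_of_le h2.le h1
      rw [sub_add_sub_cancel] at h3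
      linarith
  have hb : ∀ x, ‖f x‖ ≤ N + ‖f ⟨0, by simp⟩‖ := by
    intro x
    have h1 := key x N le_rfl
    have h2 : (((N : ℝ) / N : ℝ) : ℂ) • (x : X) = x := by
      rw [div_self hN0.ne']; simp
    simp only [h2] at h1
    have h3 := norm_sub_norm_le (f x) (f ⟨0, by simp⟩)
    have h4 : ‖f x - f ⟨0, by simp⟩‖ ≤ N := h1
    linarith
  exact ⟨⟨BoundedContinuousFunction.ofNormedAddCommGroup f hf.continuous _ hb, hf, hol⟩,
    fun _ => rfl⟩

/-- The continuous extension of `f ∈ 𝒜ᵤ(B_X)` to the closed unit ball: its value at `x` is the limit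
of `f y` as `y → x` within the open ball. -/
def ext (f : Au X) (x : closedBall (0 : X) 1) : ℂ :=
  limUnder (comap ((↑) : ball (0 : X) 1 → X) (𝓝 (x : X))) (f : ball (0 : X) 1 →ᵇ ℂ)

theorem comap_neBot (x : closedBall (0 : X) 1) :
    (comap ((↑) : ball (0 : X) 1 → X) (𝓝 (x : X))).NeBot := by
  let _ : NormedSpace ℝ X := NormedSpace.restrictScalars ℝ ℂ X
  rw [← mem_closure_iff_comap_neBot]
  rw [closure_ball (0 : X) one_ne_zero]
  exact x.2

theorem tendsto_ext (f : Au X) (x : closedBall (0 : X) 1) :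
    Tendsto (f : ball (0 : X) 1 →ᵇ ℂ) (comap ((↑) : ball (0 : X) 1 → X) (𝓝 (x : X)))
      (𝓝 (ext f x)) := by
  have := comap_neBot x
  have hc : Cauchy (comap ((↑) : ball (0 : X) 1 → X) (𝓝 (x : X))) :=
    (cauchy_nhds (a := (x : X))).comap (by rw [uniformity_subtype])
  exact (hc.map f.2.1).le_nhds_lim

/-- At points of the open ball the extension is the function itself. -/
theorem ext_eq (f : Au X) (x : ball (0 : X) 1) :
    ext f ⟨x, ball_subset_closedBall x.2⟩ = (f : ball (0 : X) 1 →ᵇ ℂ) x := by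
  have := comap_neBot (⟨x, ball_subset_closedBall x.2⟩ : closedBall (0 : X) 1)
  refine tendsto_nhds_unique (tendsto_ext f ⟨x, ball_subset_closedBall x.2⟩) ?_
  have h := (f : ball (0 : X) 1 →ᵇ ℂ).continuous.tendsto x
  rwa [nhds_subtype_eq_comap] at h

theorem ext_eq_of_tendsto {f : Au X} {x : closedBall (0 : X) 1} {c : ℂ}
    (h : Tendsto (f : ball (0 : X) 1 →ᵇ ℂ) (comap ((↑) : ball (0 : X) 1 → X) (𝓝 (x : X))) (𝓝 c)) :
    ext f x = c :=
  haveI := comap_neBot x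
  tendsto_nhds_unique (tendsto_ext f x) h

variable (X) in
/-- The spectrum `ℳ(𝒜ᵤ(B_X))`: the nonzero multiplicative continuous linear functionals, with the
weak-star topology. -/
abbrev Spectrum : Type _ := characterSpace ℂ (Au X)

/-- The evaluation homomorphism `δ_x`, for `x` in the closed unit ball. -/
def delta (x : closedBall (0 : X) 1) : Spectrum X :=
  ⟨StrongDual.toWeakDual (LinearMap.mkContinuous
      { toFun := fun f : Au X => ext f x
        map_add' := fun f g => ext_eq_of_tendsto ((tendsto_ext f x).add (tendsto_ext g x))
        map_smul' := fun c f => ext_eq_of_tendsto ((tendsto_ext f x).const_smul c) }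
      1 (fun f => by
        have := comap_neBot x
        rw [one_mul]
        exact le_of_tendsto (tendsto_ext f x).norm
          (Eventually.of_forall fun y => (f : ball (0 : X) 1 →ᵇ ℂ).norm_coe_le_norm y))), by
    refine ⟨fun h => ?_, fun f g => ext_eq_of_tendsto ((tendsto_ext f x).mul (tendsto_ext g x))⟩
    have h1 : ext (1 : Au X) x = 0 := DFunLike.congr_fun h (1 : Au X)
    have h2 : ext (1 : Au X) x = 1 := ext_eq_of_tendsto tendsto_const_nhds
    exact one_ne_zero (h2.symm.trans h1)⟩

@[simp]
theorem delta_apply (x : closedBall (0 : X) 1) (f : Au X) : delta x f = ext f x := rfl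

/-- The Gleason part of `φ`: all `ψ` in the spectrum with `‖φ - ψ‖ < 2` in the dual norm. -/
def gleasonPart (φ : Spectrum X) : Set (Spectrum X) :=
  {ψ | ‖CharacterSpace.toCLM φ - CharacterSpace.toCLM ψ‖ < 2}

variable (X) in
/-- The evaluations `δ_x` at points `x` of the open unit ball. -/
def pointEvaluations : Set (Spectrum X) :=
  {φ | ∃ (x : X) (hx : x ∈ ball (0 : X) 1), φ = delta ⟨x, ball_subset_closedBall hx⟩}

variable (X) in
/-- The corona: the homomorphisms that are not weak-star limits of point evaluations. -/
def corona : Set (Spectrum X) := (closure (pointEvaluations X))ᶜ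

end General

section Lp

variable {p : ℝ≥0∞} [Fact (1 ≤ p)]

/-- The truncation of `z ∈ ℓ_p` to its first `n` coordinates. -/
def truncation (n : ℕ) (z : lp (fun _ : ℕ => ℂ) p) : lp (fun _ : ℕ => ℂ) p :=
  ∑ i ∈ Finset.range n, lp.single p i (z i)

/-- The vector `π_n(z) + s e_{n+1}` with `s = (1 - ‖z‖ ^ p) ^ (1 / p)`. Coordinates are numbered from
`0` here, so the canonical vector `e_{n+1}` is the one with a `1` at index `n`. -/
def peakVector (z : lp (fun _ : ℕ => ℂ) p) (n : ℕ) : lp (fun _ : ℕ => ℂ) p :=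
  truncation n z + lp.single p n (((1 - ‖z‖ ^ p.toReal) ^ (1 / p.toReal) : ℝ) : ℂ)

theorem peakVector_mem_closedBall (hp : p ≠ ∞) {z : lp (fun _ : ℕ => ℂ) p}
    (hz : z ∈ ball (0 : lp (fun _ : ℕ => ℂ) p) 1) (n : ℕ) :
    peakVector z n ∈ closedBall (0 : lp (fun _ : ℕ => ℂ) p) 1 := by
  have hp0 : 0 < p.toReal :=
    ENNReal.toReal_pos (one_pos.trans_le (Fact.out : 1 ≤ p)).ne' hp
  obtain ⟨s, hs⟩ : ∃ s : ℝ, s = (1 - ‖z‖ ^ p.toReal) ^ (1 / p.toReal) := ⟨_, rfl⟩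
  have hz1 : ‖z‖ ^ p.toReal ≤ 1 :=
    Real.rpow_le_one (norm_nonneg _) (mem_ball_zero_iff.1 hz).le hp0.le
  have hs0 : 0 ≤ s := by rw [hs]; exact Real.rpow_nonneg (by linarith) _
  have hsp : s ^ p.toReal = 1 - ‖z‖ ^ p.toReal := by
    rw [hs, one_div, Real.rpow_inv_rpow (by linarith) hp0.ne']
  have heq : peakVector z n =
      ∑ i ∈ Finset.range (n + 1), lp.single p i (Function.update (⇑z) n (s : ℂ) i) := by
    rw [Finset.sum_range_succ, peakVector, truncation, ← hs, Function.update_self]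
    congr 1
    refine Finset.sum_congr rfl fun i hi => ?_
    rw [Function.update_of_ne (Finset.mem_range.1 hi).ne]
  have hnorm : ‖peakVector z n‖ ^ p.toReal ≤ 1 ^ p.toReal := by
    rw [heq, lp.norm_sum_single hp0, Finset.sum_range_succ, Function.update_self,
      Complex.norm_real, Real.norm_of_nonneg hs0, hsp, Real.one_rpow]
    have h1 : ∑ i ∈ Finset.range n, ‖Function.update (⇑z) n (s : ℂ) i‖ ^ p.toReal =
        ∑ i ∈ Finset.range n, ‖z i‖ ^ p.toReal :=
      Finset.sum_congr rfl fun i hi => by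
        rw [Function.update_of_ne (Finset.mem_range.1 hi).ne]
    have h2 := lp.sum_rpow_le_norm_rpow hp0 z (Finset.range n)
    rw [h1]
    linarith
  rw [mem_closedBall_zero_iff]
  exact (Real.rpow_le_rpow_iff (norm_nonneg _) zero_le_one hp0).1 hnorm

/-- The homomorphism `δ_{π_n(z) + s e_{n+1}}`. -/
def peakEvaluation (hp : p ≠ ∞) {z : lp (fun _ : ℕ => ℂ) p}
    (hz : z ∈ ball (0 : lp (fun _ : ℕ => ℂ) p) 1) (n : ℕ) : Spectrum (lp (fun _ : ℕ => ℂ) p) :=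
  delta ⟨peakVector z n, peakVector_mem_closedBall hp hz n⟩

end Lp

end

end BallAlgebra

/-!
Write `P` for the exponent, `t = ‖z‖ ^ P`, `s = (1 - t) ^ (1 / P)` and `y n` for the vector
`peakVector z n`, which has norm at most one. Fix an integer `N > P`. For a set `A` of indices and
`k : ℕ` consider

`F k x = exp ((N / s ^ P) * (∑_{i < k} ζ i * x i - t)) * s ^ (-N) * ∑_{n ∈ A, k ≤ n} x n ^ N`,

where `ζ i = conj (z i) * |z i| ^ (P - 2)` (`peakFun`). It belongs to the ball algebra
(`exists_Au_peakFun`), as the power sum is a continuous `N`-homogeneous polynomial for `N > P`.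
Young's inequality for each `ζ i * x i` and `w * exp (1 - w) ≤ 1` for `w = s ^ (-P)` times the mass
of `x` on `{n ∈ A | k ≤ n}` give `|F k x| ≤ 1` on the unit ball (`norm_peakFun_le`), while
`F k (y n)` is close to one for all `n ∈ A` with `k ≤ n`, when `k` is large
(`norm_peakFun_sub_one_le`).

If `x k` is a sequence in the ball with `F k (x k) → 1`, then no inequality may lose anything in the
limit: Young's inequality forces `x k i → z i` for each `i`, and the mass of `x k` on the
indices in `A` beyond `k` tends to `s ^ P`. Because `N > P`, this mass concentrates on one
coordinate `n k ∈ A`, so `|x k (n k)| → s`, and using the exponent `N + 1` as well gives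
`x k (n k) → s`. As no mass is left over, `‖x k - y (n k)‖ → 0` (`exists_tendsto_of_tendsto_peakFun`, `tendsto_mass_sub`).

Now let `φ` be the limit of the `δ_{y n}` along an ultrafilter and let `ψ` be a limit of point
evaluations in its Gleason part. For `g` in the algebra and `ε > 0`, the set
`A = {n | |g (y n) - φ g| < ε}` belongs to the ultrafilter, so `φ (F k) → 1`. Disc automorphisms
show that then `ψ (F k) → 1` (`tendsto_one_of_mem_gleasonPart`). Choosing `x k` in the ball whose
evaluation approximates `ψ` on `F k`, on its companion for `N + 1`, and on `g`, one finds that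
`ψ g` is a limit of values `g (y n)` with `n ∈ A`. Hence `|ψ g - φ g| ≤ ε`.
-/

namespace BallAlgebra

/-! ### The pointwise Young inequality -/

/-- The coefficient `conj b * |b| ^ (P - 2)` of the norming functional of an `ℓ_P` sequence at a
coordinate with value `b`; it vanishes for `b = 0`. -/
noncomputable def dualCoeff (P : ℝ) (b : ℂ) : ℂ :=
  (starRingEnd ℂ) b * ((‖b‖ ^ (P - 2) : ℝ) : ℂ)

/-- The defect in Young's inequality
`Re (dualCoeff P b * a) ≤ |a| ^ P / P + |b| ^ P * (1 - 1 / P)`. -/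
noncomputable def youngDefect (P : ℝ) (b a : ℂ) : ℝ :=
  ‖a‖ ^ P / P + ‖b‖ ^ P * (1 - 1 / P) - (dualCoeff P b * a).re

theorem norm_dualCoeff {P : ℝ} (hP : 1 < P) (b : ℂ) : ‖dualCoeff P b‖ = ‖b‖ ^ (P - 1) := by
  rw [dualCoeff, norm_mul, Complex.norm_conj, Complex.norm_real,
    Real.norm_of_nonneg (by positivity)]
  rcases eq_or_ne b 0 with rfl | hb
  · rw [norm_zero, zero_mul, Real.zero_rpow (by linarith)]
  · have : 0 < ‖b‖ := norm_pos_iff.2 hb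
    rw [show P - 1 = 1 + (P - 2) by ring, Real.rpow_add this, Real.rpow_one]

theorem dualCoeff_mul_self {P : ℝ} (hP : 1 < P) (b : ℂ) :
    dualCoeff P b * b = ((‖b‖ ^ P : ℝ) : ℂ) := by
  rcases eq_or_ne b 0 with rfl | hb
  · rw [norm_zero, mul_zero, Real.zero_rpow (by linarith), Complex.ofReal_zero]
  · have : 0 < ‖b‖ := norm_pos_iff.2 hb
    have h1 : (starRingEnd ℂ) b * b = ((‖b‖ ^ 2 : ℝ) : ℂ) := by
      rw [mul_comm, Complex.mul_conj, Complex.normSq_eq_norm_sq]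
    rw [dualCoeff, mul_right_comm, h1, ← Complex.ofReal_mul]
    congr 1
    rw [← Real.rpow_natCast, ← Real.rpow_add this]
    congr 1; push_cast; ring

theorem norm_dualCoeff_mul_le {P : ℝ} (hP : 1 < P) (b a : ℂ) :
    ‖dualCoeff P b * a‖ ≤ ‖a‖ ^ P / P + ‖b‖ ^ P * (1 - 1 / P) := by
  have hq := Real.HolderConjugate.conjExponent hP
  have h := Real.young_inequality_of_nonneg (norm_nonneg a)
    (Real.rpow_nonneg (norm_nonneg b) (P - 1)) hq
  rw [norm_mul, norm_dualCoeff hP, mul_comm]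
  refine h.trans_eq ?_
  have hP1 : P - 1 ≠ 0 := by linarith
  rw [← Real.rpow_mul (norm_nonneg b), Real.conjExponent, mul_div_cancel₀ _ hP1]
  congr 1
  field_simp

theorem youngDefect_nonneg {P : ℝ} (hP : 1 < P) (b a : ℂ) : 0 ≤ youngDefect P b a := by
  have := norm_dualCoeff_mul_le hP b a
  have := Complex.re_le_norm (dualCoeff P b * a)
  rw [youngDefect]; linarith

/-- Strict convexity: Young's inequality is strict away from `a = b`. -/
theorem eq_of_youngDefect_eq_zero {P : ℝ} (hP : 1 < P) {b a : ℂ} (h : youngDefect P b a = 0) :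
    a = b := by
  have hP0 : 0 < P := by linarith
  rcases eq_or_ne b 0 with rfl | hb
  · have h1 : ‖a‖ ^ P / P = 0 := by
      simpa [youngDefect, dualCoeff, Real.zero_rpow hP0.ne'] using h
    have h2 : ‖a‖ ^ P = 0 := by field_simp at h1; simpa using h1
    simpa using (Real.rpow_eq_zero (norm_nonneg a) hP0.ne').1 h2
  have hb0 : 0 < ‖b‖ := norm_pos_iff.2 hb
  have hre := Complex.re_le_norm (dualCoeff P b * a)
  have hno : ‖dualCoeff P b * a‖ = ‖b‖ ^ (P - 1) * ‖a‖ := by rw [norm_mul, norm_dualCoeff hP]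
  have hbP : ‖b‖ ^ P = ‖b‖ ^ (P - 1) * ‖b‖ := by
    rw [← Real.rpow_add_one hb0.ne', sub_add_cancel]
  have hbp : 0 < ‖b‖ ^ (P - 1) := Real.rpow_pos_of_pos hb0 _
  have hab : ‖a‖ = ‖b‖ := by
    by_contra hne
    have hber := one_add_mul_self_lt_rpow_one_add (s := ‖a‖ / ‖b‖ - 1) (p := P)
      (by have : 0 ≤ ‖a‖ / ‖b‖ := by positivity
          linarith) (by rw [sub_ne_zero, Ne, div_eq_one_iff_eq hb0.ne']; exact hne) hP
    rw [add_sub_cancel, Real.div_rpow (norm_nonneg a) hb0.le, lt_div_iff₀ (by positivity)] at hber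
    have h3 : (1 + P * (‖a‖ / ‖b‖ - 1)) * ‖b‖ ^ P =
        ‖b‖ ^ P + P * (‖b‖ ^ (P - 1) * ‖a‖ - ‖b‖ ^ P) := by
      rw [hbP]; field_simp
    rw [h3] at hber
    have h4 : youngDefect P b a * P =
      ‖a‖ ^ P + ‖b‖ ^ P * (P - 1) - P * (dualCoeff P b * a).re := by
      rw [youngDefect]; field_simp
    rw [h, zero_mul] at h4
    have := mul_le_mul_of_nonneg_left (hre.trans_eq hno) hP0.le
    nlinarith
  have h5 : (dualCoeff P b * a).re = ‖dualCoeff P b * a‖ := by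
    rw [hno, hab, ← hbP]
    have : youngDefect P b a = ‖b‖ ^ P - (dualCoeff P b * a).re := by
      rw [youngDefect, hab]; ring
    linarith
  have h6 : dualCoeff P b * a = ((‖dualCoeff P b * a‖ : ℝ) : ℂ) := by
    have h7 := Complex.re_eq_norm.1 h5
    exact (Complex.eq_coe_norm_of_nonneg h7)
  have h8 : dualCoeff P b * a = dualCoeff P b * b := by
    rw [h6, hno, hab, ← hbP, dualCoeff_mul_self hP]
  refine mul_left_cancel₀ ?_ h8
  rw [← norm_ne_zero_iff, norm_dualCoeff hP]; exact hbp.ne'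

/-- On a compact set, the values of a continuous function determine the limit of a sequence if the
limit value is taken only once. -/
theorem tendsto_of_isCompact_of_unique {ι X : Type*} [TopologicalSpace X] {l : Filter ι}
    {K : Set X} (hK : IsCompact K) {f : X → ℝ} (hf : Continuous f) {c : ℝ} {y : X}
    (huniq : ∀ x ∈ K, f x = c → x = y) {u : ι → X} (hu : ∀ᶠ i in l, u i ∈ K)
    (hlim : Tendsto (fun i => f (u i)) l (𝓝 c)) : Tendsto u l (𝓝 y) := by
  refine hK.tendsto_nhds_of_unique_mapClusterPt hu fun x hx hcl => huniq x hx ?_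
  have h1 : MapClusterPt (f x) l (f ∘ u) := hcl.continuousAt_comp hf.continuousAt
  obtain ⟨U, hU, hU2⟩ := mapClusterPt_iff_ultrafilter.1 h1
  exact tendsto_nhds_unique hU2 (hlim.mono_left hU)

theorem continuous_youngDefect {P : ℝ} (hP : 1 < P) (b : ℂ) : Continuous (youngDefect P b) := by
  unfold youngDefect
  have : Continuous fun a : ℂ => ‖a‖ ^ P :=
    continuous_norm.rpow_const fun _ => Or.inr (by linarith)
  fun_prop

theorem tendsto_of_youngDefect {ι : Type*} {l : Filter ι} {P : ℝ} (hP : 1 < P) {b : ℂ} {u : ι → ℂ}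
    (hu : ∀ᶠ i in l, ‖u i‖ ≤ 1) (h : Tendsto (fun i => youngDefect P b (u i)) l (𝓝 0)) :
    Tendsto u l (𝓝 b) :=
  tendsto_of_isCompact_of_unique (isCompact_closedBall (0 : ℂ) 1) (continuous_youngDefect hP b)
    (fun _ _ hx => eq_of_youngDefect_eq_zero hP hx)
    (hu.mono fun _ hi => mem_closedBall_zero_iff.2 hi) h

theorem mul_exp_one_sub_le (w : ℝ) : w * Real.exp (1 - w) ≤ 1 := by
  have h := Real.add_one_le_exp (w - 1)
  rw [sub_add_cancel] at h
  calc w * Real.exp (1 - w) ≤ Real.exp (w - 1) * Real.exp (1 - w) := by gcongr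
    _ = 1 := by rw [← Real.exp_add]; simp

theorem tendsto_one_of_mul_exp_one_sub {ι : Type*} {l : Filter ι} {C : ℝ} {w : ι → ℝ}
    (hw : ∀ᶠ i in l, w i ∈ Set.Icc 0 C)
    (h : Tendsto (fun i => w i * Real.exp (1 - w i)) l (𝓝 1)) : Tendsto w l (𝓝 1) := by
  refine tendsto_of_isCompact_of_unique (f := fun w : ℝ => w * Real.exp (1 - w)) isCompact_Icc
    (by fun_prop) (fun x _ hx => ?_) hw h
  by_contra hne
  have h1 := Real.add_one_lt_exp (sub_ne_zero.2 hne)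
  rw [sub_add_cancel] at h1
  have h2 := mul_lt_mul_of_pos_right h1 (Real.exp_pos (1 - x))
  rw [← Real.exp_add] at h2
  simp only [hx] at h2
  simp at h2

/-! ### Masses and power sums over sets of coordinates -/

/-- The `P`-th power sum of the absolute values of the coordinates of `x` in `B`. -/
noncomputable def mass (P : ℝ) (B : Set ℕ) (x : ℕ → ℂ) : ℝ := ∑' n : B, ‖x n‖ ^ P

/-- The sum of the `N`-th powers of the coordinates of `x` in `B`. -/
noncomputable def powerSum (B : Set ℕ) (N : ℕ) (x : ℕ → ℂ) : ℂ := ∑' n : B, x n ^ N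

section mass

variable {P : ℝ} {x : ℕ → ℂ}

theorem mass_nonneg (B : Set ℕ) : 0 ≤ mass P B x :=
  tsum_nonneg fun _ => by positivity

theorem mass_union (hx : Summable fun n => ‖x n‖ ^ P) {B C : Set ℕ} (h : Disjoint B C) :
    mass P (B ∪ C) x = mass P B x + mass P C x :=
  (hx.subtype B).tsum_union_disjoint h (hx.subtype C)

theorem mass_mono (hx : Summable fun n => ‖x n‖ ^ P) {B C : Set ℕ} (h : B ⊆ C) :
    mass P B x ≤ mass P C x := by
  have h1 := mass_union hx (disjoint_sdiff_self_right (x := B) (y := C))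
  rw [Set.union_sdiff_cancel h] at h1
  have := mass_nonneg (P := P) (x := x) (C \ B)
  linarith

theorem mass_finset (S : Finset ℕ) : mass P (S : Set ℕ) x = ∑ i ∈ S, ‖x i‖ ^ P :=
  S.tsum_subtype fun i => ‖x i‖ ^ P

theorem mass_singleton (n : ℕ) : mass P {n} x = ‖x n‖ ^ P := by
  rw [← Finset.coe_singleton, mass_finset, Finset.sum_singleton]

theorem mass_univ : mass P Set.univ x = ∑' n, ‖x n‖ ^ P :=
  tsum_univ fun n => ‖x n‖ ^ P

theorem sum_add_mass_le (hx : Summable fun n => ‖x n‖ ^ P) {S : Finset ℕ} {B : Set ℕ}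
    (h : Disjoint (S : Set ℕ) B) :
    ∑ i ∈ S, ‖x i‖ ^ P + mass P B x ≤ mass P Set.univ x := by
  rw [← mass_finset, ← mass_union hx h]
  exact mass_mono hx (Set.subset_univ _)

theorem norm_rpow_le_mass (hx : Summable fun n => ‖x n‖ ^ P) {B : Set ℕ} {n : ℕ}
    (hn : n ∈ B) : ‖x n‖ ^ P ≤ mass P B x := by
  rw [← mass_singleton]
  exact mass_mono hx (Set.singleton_subset_iff.2 hn)

theorem norm_le_one_of_mass_le (hP : 0 < P) (hx : Summable fun n => ‖x n‖ ^ P)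
    (h : mass P Set.univ x ≤ 1) (n : ℕ) : ‖x n‖ ≤ 1 := by
  have := (norm_rpow_le_mass hx (Set.mem_univ n)).trans h
  rw [← Real.one_rpow P] at this
  exact (Real.rpow_le_rpow_iff (norm_nonneg _) zero_le_one hP).1 this

theorem norm_pow_eq (hP : 0 < P) {N : ℕ} (hN : P < N) (n : ℕ) :
    ‖x n ^ N‖ = ‖x n‖ ^ ((N : ℝ) - P) * ‖x n‖ ^ P := by
  rw [norm_pow, ← Real.rpow_natCast, ← Real.rpow_add' (norm_nonneg _)
    (by rw [sub_add_cancel]; exact (hP.trans hN).ne')]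
  simp

/-- If the coordinates are at most `1`, so that `|x n| ^ N ≤ |x n| ^ P`, the power sums converge. -/
theorem summable_pow (hP : 0 < P) (hx : Summable fun n => ‖x n‖ ^ P)
    (h1 : ∀ n, ‖x n‖ ≤ 1) {N : ℕ} (hN : P < N) : Summable fun n => x n ^ N := by
  refine Summable.of_norm_bounded hx fun n => ?_
  rw [norm_pow_eq hP hN]
  exact mul_le_of_le_one_left (by positivity)
    (Real.rpow_le_one (norm_nonneg _) (h1 n) (by linarith))

theorem norm_powerSum_le_mul (hP : 0 < P) (hx : Summable fun n => ‖x n‖ ^ P)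
    {B : Set ℕ} {N : ℕ} (hN : P < N) {c : ℝ}
    (hc : ∀ n ∈ B, ‖x n‖ ^ ((N : ℝ) - P) ≤ c) : ‖powerSum B N x‖ ≤ c * mass P B x := by
  rw [mass, ← tsum_mul_left]
  refine tsum_of_norm_bounded ((hx.subtype B).mul_left c).hasSum fun n => ?_
  rw [norm_pow_eq hP hN]
  exact mul_le_mul_of_nonneg_right (hc n n.2) (by positivity)

theorem rpow_sub_le_mass (hP : 0 < P) (hx : Summable fun n => ‖x n‖ ^ P) {B : Set ℕ} {N : ℕ}
    (hN : P < N) {n : ℕ} (hn : n ∈ B) :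
    ‖x n‖ ^ ((N : ℝ) - P) ≤ mass P B x ^ (((N : ℝ) - P) / P) := by
  calc ‖x n‖ ^ ((N : ℝ) - P) = (‖x n‖ ^ P) ^ (((N : ℝ) - P) / P) := by
        rw [← Real.rpow_mul (norm_nonneg _), mul_div_cancel₀ _ hP.ne']
    _ ≤ _ := Real.rpow_le_rpow (by positivity) (norm_rpow_le_mass hx hn)
        (div_nonneg (by linarith) hP.le)

theorem norm_powerSum_le (hP : 0 < P) (hx : Summable fun n => ‖x n‖ ^ P)
    {B : Set ℕ} {N : ℕ} (hN : P < N) :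
    ‖powerSum B N x‖ ≤ mass P B x ^ ((N : ℝ) / P) := by
  refine (norm_powerSum_le_mul hP hx hN fun n hn => rpow_sub_le_mass hP hx hN hn).trans_eq ?_
  rw [← Real.rpow_add_one' (mass_nonneg B) (by
    have : 0 < (N : ℝ) / P := div_pos (by linarith) hP
    rw [sub_div, div_self hP.ne']; simpa using this.ne')]
  congr 1
  field_simp; ring

theorem norm_powerSum_sub_le (hP : 0 < P) (hx : Summable fun n => ‖x n‖ ^ P)
    (h1 : ∀ n, ‖x n‖ ≤ 1) {B : Set ℕ} {N : ℕ} (hN : P < N) {n : ℕ} (hn : n ∈ B) :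
    ‖powerSum B N x - x n ^ N‖ ≤ mass P B x - ‖x n‖ ^ P := by
  have hd : Disjoint ({n} : Set ℕ) (B \ {n}) := disjoint_sdiff_self_right
  have hu : {n} ∪ (B \ {n}) = B := Set.union_sdiff_cancel (Set.singleton_subset_iff.2 hn)
  have hs := summable_pow hP hx h1 hN
  have h2 : powerSum B N x = powerSum {n} N x + powerSum (B \ {n}) N x := by
    conv_lhs => rw [← hu]
    exact (hs.subtype ({n} : Set ℕ)).tsum_union_disjoint hd (hs.subtype (B \ {n} : Set ℕ))
  have h3 : powerSum {n} N x = x n ^ N := by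
    rw [powerSum, tsum_singleton n fun i => x i ^ N]
  have h4 := mass_union hx hd
  rw [hu, mass_singleton] at h4
  rw [h2, h3, add_sub_cancel_left, h4, add_sub_cancel_left]
  refine (norm_powerSum_le_mul hP hx hN (c := 1) fun i _ => ?_).trans_eq (one_mul _)
  exact Real.rpow_le_one (norm_nonneg _) (h1 i) (by linarith)

end mass

/-! ### The peaking functions -/

/-- The function
`exp ((N / s ^ P) * (∑_{i < k} dualCoeff P (z i) * x i - t)) * s ^ (-N) * ∑_{n ∈ B} x n ^ N`.
With `t = ‖z‖ ^ P` and `s ^ P + t = 1` it has supremum at most `1` on the unit ball of `ℓ_P` when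
all elements of `B` are at least `k`. The factor `N / s ^ P` is the one for which the logarithm of
the modulus is critical at mass `s ^ P` on `B` and first coordinates `z i`. -/
noncomputable def peakFun (P s t : ℝ) (z : ℕ → ℂ) (N k : ℕ) (B : Set ℕ) (x : ℕ → ℂ) : ℂ :=
  Complex.exp (((N / s ^ P : ℝ) : ℂ) *
    (∑ i ∈ Finset.range k, dualCoeff P (z i) * x i - (t : ℂ))) *
    (((s ^ N : ℝ) : ℂ)⁻¹ * powerSum B N x)

section peakFun

variable {P s t : ℝ} {z x : ℕ → ℂ} {N k : ℕ} {B : Set ℕ}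

/-- The three sources of loss in `‖peakFun‖ ≤ 1` are separated: Young's inequality in the first
`k` coordinates, the inequality `w * exp (1 - w) ≤ 1` for the mass `w` on `B`, and the comparison
of the power sum with the mass. -/
theorem norm_peakFun_le (hP : 1 < P) (hs : 0 < s) (hst : s ^ P + t = 1)
    (hz : Summable fun n => ‖z n‖ ^ P) (hzt : mass P Set.univ z = t)
    (hx : Summable fun n => ‖x n‖ ^ P) (hx1 : mass P Set.univ x ≤ 1) (hB : ∀ n ∈ B, k ≤ n) :
    ‖peakFun P s t z N k B x‖ ≤
      Real.exp (-(N / s ^ P * ∑ i ∈ Finset.range k, youngDefect P (z i) (x i))) *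
        (Real.exp (N / P * (1 - mass P B x / s ^ P)) * (‖powerSum B N x‖ / s ^ N)) := by
  have hP0 : 0 < P := by linarith
  have hsP : 0 < s ^ P := Real.rpow_pos_of_pos hs P
  rw [peakFun, norm_mul, Complex.norm_exp, ← mul_assoc, ← Real.exp_add, norm_mul, norm_inv,
    Complex.norm_real, Real.norm_of_nonneg (by positivity), inv_mul_eq_div]
  refine mul_le_mul_of_nonneg_right (Real.exp_le_exp.2 ?_) (by positivity)
  rw [Complex.re_ofReal_mul, Complex.sub_re, Complex.ofReal_re, Complex.re_sum]
  have hd : Disjoint ((Finset.range k : Finset ℕ) : Set ℕ) B :=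
    Set.disjoint_left.2 fun i hi hiB => by
      have := hB i hiB
      simp at hi; omega
  have h1 := (sum_add_mass_le hx hd).trans hx1
  have h2 : ∑ i ∈ Finset.range k, ‖z i‖ ^ P ≤ t := by
    rw [← hzt, ← mass_finset]; exact mass_mono hz (Set.subset_univ _)
  have h3 : ∑ i ∈ Finset.range k, (dualCoeff P (z i) * x i).re =
      (∑ i ∈ Finset.range k, ‖x i‖ ^ P) / P + (∑ i ∈ Finset.range k, ‖z i‖ ^ P) * (1 - 1 / P) -
        ∑ i ∈ Finset.range k, youngDefect P (z i) (x i) := by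
    rw [Finset.sum_div, Finset.sum_mul, ← Finset.sum_add_distrib, ← Finset.sum_sub_distrib]
    refine Finset.sum_congr rfl fun i _ => ?_
    rw [youngDefect]; ring
  have h4 : (∑ i ∈ Finset.range k, ‖x i‖ ^ P) / P ≤ (1 - mass P B x) / P := by
    gcongr; linarith
  have h5 : (∑ i ∈ Finset.range k, ‖z i‖ ^ P) * (1 - 1 / P) ≤ t * (1 - 1 / P) := by
    have : 1 / P ≤ 1 := (div_le_one hP0).2 hP.le
    gcongr
  have h6 : ∑ i ∈ Finset.range k, (dualCoeff P (z i) * x i).re - t ≤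
      (s ^ P - mass P B x) / P - ∑ i ∈ Finset.range k, youngDefect P (z i) (x i) := by
    have h7 : (1 - mass P B x) / P + t * (1 - 1 / P) - t = (s ^ P - mass P B x) / P := by
      rw [show s ^ P = 1 - t by linarith]; field_simp; ring
    linarith
  refine (mul_le_mul_of_nonneg_left h6 (by positivity)).trans_eq ?_
  field_simp; ring

theorem powerSum_div_le (hP : 0 < P) (hs : 0 < s) (hx : Summable fun n => ‖x n‖ ^ P)
    (hN : P < N) : ‖powerSum B N x‖ / s ^ N ≤ (mass P B x / s ^ P) ^ ((N : ℝ) / P) := by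
  rw [Real.div_rpow (mass_nonneg B) (by positivity), ← Real.rpow_mul hs.le,
    mul_div_cancel₀ _ hP.ne', Real.rpow_natCast]
  gcongr
  exact norm_powerSum_le hP hx hN

theorem exp_mul_powerSum_div_le (hP : 0 < P) (hs : 0 < s) (hx : Summable fun n => ‖x n‖ ^ P)
    (hN : P < N) :
    Real.exp (N / P * (1 - mass P B x / s ^ P)) * (‖powerSum B N x‖ / s ^ N) ≤
      (mass P B x / s ^ P * Real.exp (1 - mass P B x / s ^ P)) ^ ((N : ℝ) / P) := by
  have := mass_nonneg (P := P) (x := x) B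
  rw [Real.mul_rpow (by positivity) (Real.exp_pos _).le, ← Real.exp_mul, mul_comm (1 - _), mul_comm]
  exact mul_le_mul_of_nonneg_right (powerSum_div_le hP hs hx hN) (Real.exp_pos _).le

theorem mul_exp_rpow_le_one (hs : 0 < s) (r : ℝ) (hr : 0 ≤ r) :
    (mass P B x / s ^ P * Real.exp (1 - mass P B x / s ^ P)) ^ r ≤ 1 := by
  have := mass_nonneg (P := P) (x := x) B
  exact Real.rpow_le_one (by positivity) (mul_exp_one_sub_le _) hr

theorem exp_neg_sum_youngDefect_le_one (hP : 1 < P) (hs : 0 < s) :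
    Real.exp (-(N / s ^ P * ∑ i ∈ Finset.range k, youngDefect P (z i) (x i))) ≤ 1 := by
  rw [Real.exp_le_one_iff, neg_nonpos]
  exact mul_nonneg (by positivity) (Finset.sum_nonneg fun i _ => youngDefect_nonneg hP _ _)

theorem norm_peakFun_le_one (hP : 1 < P) (hs : 0 < s) (hst : s ^ P + t = 1)
    (hz : Summable fun n => ‖z n‖ ^ P) (hzt : mass P Set.univ z = t)
    (hx : Summable fun n => ‖x n‖ ^ P) (hx1 : mass P Set.univ x ≤ 1) (hB : ∀ n ∈ B, k ≤ n)
    (hN : P < N) : ‖peakFun P s t z N k B x‖ ≤ 1 := by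
  have hP0 : 0 < P := by linarith
  refine (norm_peakFun_le hP hs hst hz hzt hx hx1 hB).trans
    (mul_le_one₀ (exp_neg_sum_youngDefect_le_one hP hs) (by positivity) ?_)
  exact (exp_mul_powerSum_div_le hP0 hs hx hN).trans (mul_exp_rpow_le_one hs _ (by positivity))

end peakFun

/-! ### Sequences along which the peaking functions tend to one -/

theorem tendsto_zero_of_le_of_tendsto {e : ℕ → ℝ} (he : ∀ k, 0 ≤ e k) {b : ℕ → ℕ → ℝ} {c : ℕ → ℝ}
    (h1 : ∀ m, ∀ᶠ k in atTop, e k ≤ b m k) (h2 : ∀ m, Tendsto (b m) atTop (𝓝 (c m)))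
    (h3 : Tendsto c atTop (𝓝 0)) : Tendsto e atTop (𝓝 0) := by
  rw [tendsto_order]
  refine ⟨fun a ha => Eventually.of_forall fun k => ha.trans_le (he k), fun a ha => ?_⟩
  obtain ⟨m, hm⟩ := (h3.eventually_lt_const ha).exists
  filter_upwards [h1 m, (h2 m).eventually_lt_const hm] with k hk hk'
  exact hk.trans_lt hk'

theorem tendsto_rpow_of_tendsto_rpow {ι : Type*} {l : Filter ι} {u : ι → ℝ} (hu : ∀ i, 0 ≤ u i)
    {a r : ℝ} (ha : 0 ≤ a) (hr : 0 < r) (h : Tendsto (fun i => u i ^ r) l (𝓝 (a ^ r))) :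
    Tendsto u l (𝓝 a) := by
  have h1 := h.rpow_const (p := r⁻¹) (Or.inr (by positivity))
  rw [Real.rpow_rpow_inv ha hr.ne'] at h1
  exact h1.congr fun i => Real.rpow_rpow_inv (hu i) hr.ne'

section limits

variable {P s t : ℝ} {z : ℕ → ℂ} {N : ℕ} {A : Set ℕ} {x : ℕ → ℕ → ℂ}

theorem tendsto_sum_range_rpow (hz : Summable fun n => ‖z n‖ ^ P) (hzt : mass P Set.univ z = t) :
    Tendsto (fun m => ∑ i ∈ Finset.range m, ‖z i‖ ^ P) atTop (𝓝 t) := by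
  rw [← hzt, mass_univ]; exact hz.hasSum.tendsto_sum_nat

/-- Each of the three sources of loss has to vanish in the limit. -/
theorem tendsto_of_tendsto_peakFun (hP : 1 < P) (hs : 0 < s) (hst : s ^ P + t = 1)
    (hz : Summable fun n => ‖z n‖ ^ P) (hzt : mass P Set.univ z = t)
    (hx : ∀ k, Summable fun n => ‖x k n‖ ^ P) (hx1 : ∀ k, mass P Set.univ (x k) ≤ 1)
    (hN : P < N)
    (hF : Tendsto (fun k => peakFun P s t z N k (A ∩ Set.Ici k) (x k)) atTop (𝓝 1)) :
    Tendsto (fun k => ∑ i ∈ Finset.range k, youngDefect P (z i) (x k i)) atTop (𝓝 0) ∧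
    Tendsto (fun k => mass P (A ∩ Set.Ici k) (x k)) atTop (𝓝 (s ^ P)) ∧
    Tendsto (fun k => ‖powerSum (A ∩ Set.Ici k) N (x k)‖) atTop (𝓝 (s ^ N)) := by
  have hP0 : 0 < P := by linarith
  have hsP : 0 < s ^ P := Real.rpow_pos_of_pos hs P
  have hN0 : (0 : ℝ) < N := by linarith
  have hF1 := hF.norm
  rw [norm_one] at hF1
  obtain ⟨W, hW⟩ : ∃ W : ℕ → ℝ, ∀ k, W k = mass P (A ∩ Set.Ici k) (x k) / s ^ P :=
    ⟨_, fun _ => rfl⟩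
  obtain ⟨Q, hQ⟩ : ∃ Q : ℕ → ℝ, ∀ k, Q k = ‖powerSum (A ∩ Set.Ici k) N (x k)‖ / s ^ N :=
    ⟨_, fun _ => rfl⟩
  obtain ⟨G, hG⟩ : ∃ G : ℕ → ℝ, ∀ k, G k =
    ∑ i ∈ Finset.range k, youngDefect P (z i) (x k i) := ⟨_, fun _ => rfl⟩
  have hW0 : ∀ k, 0 ≤ W k := fun k => by
    rw [hW]; exact div_nonneg (mass_nonneg _) hsP.le
  have hQ0 : ∀ k, 0 ≤ Q k := fun k => by rw [hQ]; positivity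
  have hle : ∀ k, ‖peakFun P s t z N k (A ∩ Set.Ici k) (x k)‖ ≤
      Real.exp (-(N / s ^ P * G k)) * (Real.exp (N / P * (1 - W k)) * Q k) := fun k => by
    rw [hG, hW, hQ]
    exact norm_peakFun_le hP hs hst hz hzt (hx k) (hx1 k) fun n hn => hn.2
  have hGexp : ∀ k, Real.exp (-(N / s ^ P * G k)) ≤ 1 := fun k => by
    rw [hG]; exact exp_neg_sum_youngDefect_le_one hP hs
  have hWQ : ∀ k, Real.exp (N / P * (1 - W k)) * Q k ≤
      (W k * Real.exp (1 - W k)) ^ ((N : ℝ) / P) := fun k => by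
    rw [hW, hQ]; exact exp_mul_powerSum_div_le hP0 hs (hx k) hN
  have hWexp : ∀ k, (W k * Real.exp (1 - W k)) ^ ((N : ℝ) / P) ≤ 1 := fun k => by
    rw [hW]; exact mul_exp_rpow_le_one hs _ (by positivity)
  have hlim1 : Tendsto (fun k => Real.exp (-(N / s ^ P * G k))) atTop (𝓝 1) :=
    tendsto_of_tendsto_of_tendsto_of_le_of_le hF1 tendsto_const_nhds
      (fun k => (hle k).trans (mul_le_of_le_one_right (Real.exp_pos _).le
        ((hWQ k).trans (hWexp k)))) hGexp
  have hFQ : ∀ k, ‖peakFun P s t z N k (A ∩ Set.Ici k) (x k)‖ ≤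
      Real.exp (N / P * (1 - W k)) * Q k := fun k =>
    (hle k).trans (mul_le_of_le_one_left (mul_nonneg (Real.exp_pos _).le (hQ0 k)) (hGexp k))
  have hlim2 : Tendsto (fun k => (W k * Real.exp (1 - W k)) ^ ((N : ℝ) / P)) atTop
      (𝓝 (1 ^ ((N : ℝ) / P))) := by
    rw [Real.one_rpow]
    exact tendsto_of_tendsto_of_tendsto_of_le_of_le hF1 tendsto_const_nhds
      (fun k => (hFQ k).trans (hWQ k)) hWexp
  have hlimW : Tendsto W atTop (𝓝 1) := by
    refine tendsto_one_of_mul_exp_one_sub (C := 1 / s ^ P)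
      (Eventually.of_forall fun k => ⟨hW0 k, ?_⟩)
      (tendsto_rpow_of_tendsto_rpow (fun k => mul_nonneg (hW0 k) (Real.exp_pos _).le)
        zero_le_one (by positivity) hlim2)
    rw [hW]
    gcongr
    exact (mass_mono (hx k) (Set.subset_univ _)).trans (hx1 k)
  have hlimQ : Tendsto Q atTop (𝓝 1) := by
    have hcont : Tendsto (fun k => Real.exp (-(N / P * (1 - W k)))) atTop (𝓝 1) := by
      have h1 : Tendsto (fun k => Real.exp (-(N / P * (1 - W k)))) atTop
          (𝓝 (Real.exp (-(N / P * (1 - 1))))) :=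
        (Real.continuous_exp.tendsto _).comp ((hlimW.const_sub 1).const_mul _).neg
      simpa using h1
    have hlow : Tendsto (fun k => Real.exp (-(N / P * (1 - W k))) *
        ‖peakFun P s t z N k (A ∩ Set.Ici k) (x k)‖) atTop (𝓝 1) := by
      simpa using hcont.mul hF1
    have hup : Tendsto (fun k => W k ^ ((N : ℝ) / P)) atTop (𝓝 1) := by
      simpa using hlimW.rpow_const (p := (N : ℝ) / P) (Or.inl one_ne_zero)
    refine tendsto_of_tendsto_of_tendsto_of_le_of_le hlow hup (fun k => ?_) (fun k => ?_)
    · refine (mul_le_mul_of_nonneg_left (hFQ k) (Real.exp_pos _).le).trans_eq ?_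
      rw [← mul_assoc, ← Real.exp_add]; simp
    · rw [hQ, hW]; exact powerSum_div_le hP0 hs (hx k) hN
  refine ⟨?_, ?_, ?_⟩
  · have h1 := ((Real.continuousAt_log one_ne_zero).tendsto.comp hlim1).const_mul (-(s ^ P / N))
    simp only [Real.log_one, mul_zero] at h1
    refine h1.congr fun k => ?_
    simp only [Function.comp_apply, Real.log_exp, ← hG]
    field_simp
  · have h1 := hlimW.mul_const (s ^ P)
    rw [one_mul] at h1
    refine h1.congr fun k => ?_
    rw [hW]; field_simp
  · have h1 := hlimQ.mul_const (s ^ N)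
    rw [one_mul] at h1
    refine h1.congr fun k => ?_
    rw [hQ]; field_simp

/-- Since `N > P`, a power sum as large as the mass allows concentrates on one coordinate. -/
theorem exists_coordinate_tendsto (hP : 0 < P) (hs : 0 < s)
    (hx : ∀ k, Summable fun n => ‖x k n‖ ^ P) (hN : P < N) {B : ℕ → Set ℕ}
    (hV : Tendsto (fun k => mass P (B k) (x k)) atTop (𝓝 (s ^ P)))
    (hQ : Tendsto (fun k => ‖powerSum (B k) N (x k)‖) atTop (𝓝 (s ^ N))) :
    ∃ n : ℕ → ℕ, (∀ᶠ k in atTop, n k ∈ B k) ∧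
      Tendsto (fun k => ‖x k (n k)‖) atTop (𝓝 s) := by
  have hsP : 0 < s ^ P := Real.rpow_pos_of_pos hs P
  have hVpos : ∀ᶠ k in atTop, 0 < mass P (B k) (x k) := hV.eventually_const_lt hsP
  -- Were all `|x k n| ^ (N - P)` at most `c k`, the power sum would be at most `c k` times the
  -- mass, which is less than the power sum itself.
  obtain ⟨c, hc⟩ : ∃ c : ℕ → ℝ, ∀ k, c k =
    ‖powerSum (B k) N (x k)‖ / mass P (B k) (x k) - 1 / ((k : ℝ) + 1) := ⟨_, fun _ => rfl⟩
  have hNP : 0 < (N : ℝ) - P := by linarith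
  have hclim : Tendsto c atTop (𝓝 (s ^ ((N : ℝ) - P))) := by
    have h1 := (hQ.div hV hsP.ne').sub tendsto_one_div_add_atTop_nhds_zero_nat
    rw [sub_zero, ← Real.rpow_natCast, ← Real.rpow_sub hs] at h1
    exact h1.congr fun k => by rw [hc]; rfl
  have hex : ∀ k, ∃ n, 0 < mass P (B k) (x k) →
      n ∈ B k ∧ c k < ‖x k n‖ ^ ((N : ℝ) - P) := by
    intro k
    by_cases hk : 0 < mass P (B k) (x k)
    · by_contra! hcon
      have h1 := norm_powerSum_le_mul hP (hx k) hN (c := c k) fun n hn => (hcon n).2 hn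
      rw [hc, sub_mul, div_mul_cancel₀ _ hk.ne'] at h1
      have : 0 < 1 / ((k : ℝ) + 1) * mass P (B k) (x k) := by positivity
      linarith
    · exact ⟨0, fun h => absurd h hk⟩
  choose n hn using hex
  refine ⟨n, hVpos.mono fun k hk => (hn k hk).1, ?_⟩
  refine tendsto_rpow_of_tendsto_rpow (fun k => norm_nonneg _) hs.le hNP ?_
  have hup := hV.rpow_const (p := ((N : ℝ) - P) / P) (Or.inl hsP.ne')
  rw [← Real.rpow_mul hs.le, mul_div_cancel₀ _ hP.ne'] at hup
  refine tendsto_of_tendsto_of_tendsto_of_le_of_le' hclim hup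
    (hVpos.mono fun k hk => (hn k hk).2.le)
    (hVpos.mono fun k hk => rpow_sub_le_mass hP (hx k) hN (hn k hk).1)

theorem tendsto_coordinate (hP : 1 < P) (hx : ∀ k, Summable fun n => ‖x k n‖ ^ P)
    (hx1 : ∀ k, mass P Set.univ (x k) ≤ 1)
    (hG : Tendsto (fun k => ∑ i ∈ Finset.range k, youngDefect P (z i) (x k i)) atTop (𝓝 0))
    (i : ℕ) : Tendsto (fun k => x k i) atTop (𝓝 (z i)) := by
  refine tendsto_of_youngDefect hP (Eventually.of_forall fun k =>
    norm_le_one_of_mass_le (by linarith) (hx k) (hx1 k) i) ?_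
  refine squeeze_zero' (Eventually.of_forall fun k => youngDefect_nonneg hP _ _) ?_ hG
  filter_upwards [eventually_gt_atTop i] with k hk
  exact Finset.single_le_sum (f := fun i => youngDefect P (z i) (x k i))
    (fun j _ => youngDefect_nonneg hP _ _) (Finset.mem_range.2 hk)

/-- Convergence of the first coordinates, together with the bound on the total mass, controls the
norming functional: the mass left between `m` and `k` is asymptotically that of `z`. -/
theorem tendsto_sum_dualCoeff_mul (hP : 1 < P) (hst : s ^ P + t = 1)
    (hz : Summable fun n => ‖z n‖ ^ P) (hzt : mass P Set.univ z = t)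
    (hx : ∀ k, Summable fun n => ‖x k n‖ ^ P) (hx1 : ∀ k, mass P Set.univ (x k) ≤ 1)
    (hV : Tendsto (fun k => mass P (A ∩ Set.Ici k) (x k)) atTop (𝓝 (s ^ P)))
    (hcoord : ∀ i, Tendsto (fun k => x k i) atTop (𝓝 (z i))) :
    Tendsto (fun k => ∑ i ∈ Finset.range k, dualCoeff P (z i) * x k i) atTop (𝓝 (t : ℂ)) := by
  have hP0 : 0 < P := by linarith
  have hP1 : 0 ≤ 1 - 1 / P := by rw [sub_nonneg]; exact (div_le_one hP0).2 hP.le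
  rw [tendsto_iff_norm_sub_tendsto_zero]
  have hzlim := tendsto_sum_range_rpow hz hzt
  obtain ⟨Z, hZ⟩ : ∃ Z : ℕ → ℝ, ∀ m, Z m = ∑ i ∈ Finset.range m, ‖z i‖ ^ P := ⟨_, fun _ => rfl⟩
  have hZt : ∀ m, Z m ≤ t := fun m => by
    rw [hZ, ← hzt, ← mass_finset]; exact mass_mono hz (Set.subset_univ _)
  have hzlim' : Tendsto Z atTop (𝓝 t) := hzlim.congr fun m => (hZ m).symm
  refine tendsto_zero_of_le_of_tendsto (fun k => norm_nonneg _)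
    (b := fun m k => ‖∑ i ∈ Finset.range m, dualCoeff P (z i) * x k i - (Z m : ℂ)‖ +
      ((1 - mass P (A ∩ Set.Ici k) (x k) - ∑ i ∈ Finset.range m, ‖x k i‖ ^ P) / P +
        (t - Z m) * (1 - 1 / P)) + (t - Z m))
    (c := fun m => 2 * (t - Z m)) (fun m => ?_) (fun m => ?_) ?_
  · filter_upwards [eventually_ge_atTop m] with k hk
    have hsplit : ∑ i ∈ Finset.range k, dualCoeff P (z i) * x k i - (t : ℂ) =
        (∑ i ∈ Finset.range m, dualCoeff P (z i) * x k i - (Z m : ℂ)) +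
          ∑ i ∈ Finset.Ico m k, dualCoeff P (z i) * x k i + ((Z m - t : ℝ) : ℂ) := by
      rw [← Finset.sum_range_add_sum_Ico _ hk]; push_cast; ring
    have h1 : ‖((Z m - t : ℝ) : ℂ)‖ = t - Z m := by
      rw [Complex.norm_real, Real.norm_of_nonpos (by linarith [hZt m])]; ring
    have h2 : ‖∑ i ∈ Finset.Ico m k, dualCoeff P (z i) * x k i‖ ≤
        (∑ i ∈ Finset.Ico m k, ‖x k i‖ ^ P) / P +
          (∑ i ∈ Finset.Ico m k, ‖z i‖ ^ P) * (1 - 1 / P) := by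
      rw [Finset.sum_div, Finset.sum_mul, ← Finset.sum_add_distrib]
      exact norm_sum_le_of_le _ fun i _ => norm_dualCoeff_mul_le hP _ _
    have hd : Disjoint ((Finset.range k : Finset ℕ) : Set ℕ) (A ∩ Set.Ici k) :=
      Set.disjoint_left.2 fun i hi hiB => by
        have := hiB.2
        simp at hi this; omega
    have h3 := (sum_add_mass_le (hx k) hd).trans (hx1 k)
    rw [← Finset.sum_range_add_sum_Ico _ hk] at h3
    have h4 : Z k = Z m + ∑ i ∈ Finset.Ico m k, ‖z i‖ ^ P := by
      rw [hZ, hZ, Finset.sum_range_add_sum_Ico _ hk]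
    have h5 := hZt k
    have h6 : (∑ i ∈ Finset.Ico m k, ‖x k i‖ ^ P) / P ≤
        (1 - mass P (A ∩ Set.Ici k) (x k) - ∑ i ∈ Finset.range m, ‖x k i‖ ^ P) / P := by
      gcongr; linarith
    have h7 : (∑ i ∈ Finset.Ico m k, ‖z i‖ ^ P) * (1 - 1 / P) ≤ (t - Z m) * (1 - 1 / P) := by
      gcongr; linarith
    rw [hsplit]
    have h8 := norm_add₃_le (a := ∑ i ∈ Finset.range m, dualCoeff P (z i) * x k i - (Z m : ℂ))
      (b := ∑ i ∈ Finset.Ico m k, dualCoeff P (z i) * x k i) (c := ((Z m - t : ℝ) : ℂ))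
    rw [h1] at h8
    linarith
  · have h1 : Tendsto (fun k => ∑ i ∈ Finset.range m, dualCoeff P (z i) * x k i - (Z m : ℂ)) atTop
        (𝓝 0) := by
      have : Tendsto (fun k => ∑ i ∈ Finset.range m, dualCoeff P (z i) * x k i - (Z m : ℂ)) atTop
          (𝓝 (∑ i ∈ Finset.range m, dualCoeff P (z i) * z i - (Z m : ℂ))) :=
        (tendsto_finsetSum _ fun i _ => (hcoord i).const_mul _).sub_const _
      simpa [dualCoeff_mul_self hP, hZ] using this
    have h2 : Tendsto (fun k => ∑ i ∈ Finset.range m, ‖x k i‖ ^ P) atTop (𝓝 (Z m)) := by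
      rw [hZ]
      exact tendsto_finsetSum _ fun i _ => (hcoord i).norm.rpow_const (Or.inr hP0.le)
    have h3 := (h1.norm.add ((((hV.const_sub 1).sub h2).div_const P).add_const
      ((t - Z m) * (1 - 1 / P)))).add_const (t - Z m)
    have h4 : ‖(0 : ℂ)‖ + ((1 - s ^ P - Z m) / P + (t - Z m) * (1 - 1 / P)) + (t - Z m) =
        2 * (t - Z m) := by
      rw [norm_zero, show 1 - s ^ P = t by linarith]; field_simp; ring
    rwa [h4] at h3
  · simpa using (hzlim'.const_sub t).const_mul 2

/-- If the peaking functions with exponents `N` and `N + 1` both tend to one along `x`, then `x k`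
is asymptotically `z` on each coordinate and `s` on a coordinate `n k` in `A`. The two exponents
together determine the argument of the large coordinate. -/
theorem exists_tendsto_of_tendsto_peakFun (hP : 1 < P) (hs : 0 < s) (hst : s ^ P + t = 1)
    (hz : Summable fun n => ‖z n‖ ^ P) (hzt : mass P Set.univ z = t)
    (hx : ∀ k, Summable fun n => ‖x k n‖ ^ P) (hx1 : ∀ k, mass P Set.univ (x k) ≤ 1)
    (hN : P < N)
    (hF : Tendsto (fun k => peakFun P s t z N k (A ∩ Set.Ici k) (x k)) atTop (𝓝 1))
    (hF' : Tendsto (fun k => peakFun P s t z (N + 1) k (A ∩ Set.Ici k) (x k)) atTop (𝓝 1)) :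
    ∃ n : ℕ → ℕ, (∀ᶠ k in atTop, n k ∈ A ∧ k ≤ n k) ∧
      (∀ i, Tendsto (fun k => x k i) atTop (𝓝 (z i))) ∧
      Tendsto (fun k => x k (n k)) atTop (𝓝 (s : ℂ)) := by
  have hP0 : 0 < P := by linarith
  have hN1 : P < (N + 1 : ℕ) := by push_cast; linarith
  obtain ⟨hG, hV, hQ⟩ := tendsto_of_tendsto_peakFun hP hs hst hz hzt hx hx1 hN hF
  obtain ⟨n, hn, hns⟩ := exists_coordinate_tendsto hP0 hs hx hN hV hQ
  have hcoord := tendsto_coordinate hP hx hx1 hG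
  have hE := tendsto_sum_dualCoeff_mul hP hst hz hzt hx hx1 hV hcoord
  have hgap : Tendsto (fun k => mass P (A ∩ Set.Ici k) (x k) - ‖x k (n k)‖ ^ P) atTop (𝓝 0) := by
    simpa using hV.sub (hns.rpow_const (p := P) (Or.inl hs.ne'))
  have hpow : ∀ M : ℕ, P < M →
      Tendsto (fun k => peakFun P s t z M k (A ∩ Set.Ici k) (x k)) atTop (𝓝 1) →
      Tendsto (fun k => x k (n k) ^ M) atTop (𝓝 ((s : ℂ) ^ M)) := by
    intro M hM hFM
    have h1 : Tendsto (fun k => Complex.exp (-(((M / s ^ P : ℝ) : ℂ) *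
        (∑ i ∈ Finset.range k, dualCoeff P (z i) * x k i - (t : ℂ))))) atTop (𝓝 1) := by
      have h2 := (Complex.continuous_exp.tendsto _).comp
        ((hE.sub_const (t : ℂ)).const_mul ((M / s ^ P : ℝ) : ℂ)).neg
      simpa [Function.comp_def] using h2
    have h2 : Tendsto (fun k => powerSum (A ∩ Set.Ici k) M (x k)) atTop (𝓝 ((s : ℂ) ^ M)) := by
      have h3 := (h1.mul hFM).const_mul ((s ^ M : ℝ) : ℂ)
      rw [one_mul, mul_one, Complex.ofReal_pow] at h3
      refine h3.congr fun k => ?_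
      have hsM : ((s : ℂ) ^ M) ≠ 0 := pow_ne_zero _ (by exact_mod_cast hs.ne')
      rw [peakFun, ← mul_assoc (Complex.exp _), ← Complex.exp_add, neg_add_cancel,
        Complex.exp_zero, one_mul, Complex.ofReal_pow, mul_inv_cancel_left₀ hsM]
    have h3 : Tendsto (fun k => powerSum (A ∩ Set.Ici k) M (x k) - x k (n k) ^ M) atTop (𝓝 0) := by
      refine squeeze_zero_norm' ?_ hgap
      filter_upwards [hn] with k hk
      exact norm_powerSum_sub_le hP0 (hx k) (norm_le_one_of_mass_le hP0 (hx k) (hx1 k)) hM hk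
    simpa using h2.sub h3
  refine ⟨n, hn, hcoord, ?_⟩
  have hsN : ((s : ℂ) ^ N) ≠ 0 := pow_ne_zero _ (by exact_mod_cast hs.ne')
  -- The large coordinate is the quotient of its powers with exponents `N + 1` and `N`.
  have h1 := (hpow (N + 1) hN1 hF').div (hpow N hN hF) hsN
  rw [pow_succ, mul_div_cancel_left₀ _ hsN] at h1
  refine h1.congr' ?_
  filter_upwards [(hpow N hN hF).eventually_ne hsN] with k hk
  simp only [Pi.div_apply]
  rw [pow_succ, mul_div_cancel_left₀ _ hk]

theorem add_rpow_le {u v : ℝ} (hP : 0 ≤ P) (hu : 0 ≤ u) (hv : 0 ≤ v) :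
    (u + v) ^ P ≤ 2 ^ P * (u ^ P + v ^ P) := by
  have h1 : u + v ≤ 2 * max u v := by linarith [le_max_left u v, le_max_right u v]
  have h2 : (max u v) ^ P ≤ u ^ P + v ^ P := by
    rcases max_choice u v with h | h <;> rw [h]
    · linarith [Real.rpow_nonneg hv P]
    · linarith [Real.rpow_nonneg hu P]
  calc (u + v) ^ P ≤ (2 * max u v) ^ P := Real.rpow_le_rpow (by positivity) h1 hP
    _ = 2 ^ P * (max u v) ^ P := Real.mul_rpow (by norm_num) (le_max_of_le_left hu)
    _ ≤ _ := by gcongr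

/-- A Radon–Riesz property: convergence of the coordinates, without loss of mass, is convergence
in norm. The limiting vector `y k` agrees with `z` below `n k`, has coordinate `s` at `n k`, and
vanishes afterwards. -/
theorem tendsto_mass_sub (hP : 1 < P) (hs : 0 < s) (hst : s ^ P + t = 1)
    (hz : Summable fun n => ‖z n‖ ^ P) (hzt : mass P Set.univ z = t)
    (hx : ∀ k, Summable fun n => ‖x k n‖ ^ P) (hx1 : ∀ k, mass P Set.univ (x k) ≤ 1)
    {n : ℕ → ℕ} (hn : ∀ᶠ k in atTop, k ≤ n k)
    (hcoord : ∀ i, Tendsto (fun k => x k i) atTop (𝓝 (z i)))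
    (hns : Tendsto (fun k => x k (n k)) atTop (𝓝 (s : ℂ))) {y : ℕ → ℕ → ℂ}
    (hy1 : ∀ k, ∀ i < n k, y k i = z i) (hy2 : ∀ k, y k (n k) = s)
    (hy3 : ∀ k, ∀ i > n k, y k i = 0) :
    Tendsto (fun k => mass P Set.univ (fun i => x k i - y k i)) atTop (𝓝 0) := by
  have hP0 : 0 < P := by linarith
  have hzlim := tendsto_sum_range_rpow hz hzt
  refine tendsto_zero_of_le_of_tendsto (fun k => mass_nonneg _)
    (b := fun m k => ∑ i ∈ Finset.range m, ‖x k i - z i‖ ^ P + ‖x k (n k) - s‖ ^ P +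
      2 ^ P * ((1 - ∑ i ∈ Finset.range m, ‖x k i‖ ^ P - ‖x k (n k)‖ ^ P) +
        (t - ∑ i ∈ Finset.range m, ‖z i‖ ^ P)))
    (c := fun m => 2 ^ P * (2 * (t - ∑ i ∈ Finset.range m, ‖z i‖ ^ P)))
    (fun m => ?_) (fun m => ?_) ?_
  · filter_upwards [hn, eventually_ge_atTop m] with k hk hmk
    have hnm : n k ∉ Finset.range m := by simp; omega
    have hyz : ∀ i ∉ insert (n k) (Finset.range m), ‖y k i‖ ≤ ‖z i‖ := fun i hi => by
      have hi1 : i ≠ n k := fun h => hi (by simp [h])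
      rcases lt_or_gt_of_ne hi1 with h | h
      · rw [hy1 k i h]
      · rw [hy3 k i h, norm_zero]; exact norm_nonneg _
    have hpt : ∀ i ∉ insert (n k) (Finset.range m),
        ‖x k i - y k i‖ ^ P ≤ 2 ^ P * (‖x k i‖ ^ P + ‖z i‖ ^ P) := fun i hi =>
      (Real.rpow_le_rpow (norm_nonneg _) ((norm_sub_le _ _).trans
        (add_le_add_right (hyz i hi) _)) hP0.le).trans
        (add_rpow_le hP0.le (norm_nonneg _) (norm_nonneg _))
    have hsumr : Summable fun i => 2 ^ P * (‖x k i‖ ^ P + ‖z i‖ ^ P) :=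
      ((hx k).add hz).mul_left _
    have hsum : Summable fun i => ‖x k i - y k i‖ ^ P := by
      refine Summable.of_norm_bounded_eventually hsumr ?_
      refine (Finset.finite_toSet (insert (n k) (Finset.range m))).subset fun i hi => ?_
      by_contra hcon
      refine hi (show ‖‖x k i - y k i‖ ^ P‖ ≤ 2 ^ P * (‖x k i‖ ^ P + ‖z i‖ ^ P) from ?_)
      rw [Real.norm_of_nonneg (by positivity)]
      exact hpt i hcon
    have hsplit := fun (f : ℕ → ℝ) (hf : Summable f) =>
      hf.sum_add_tsum_compl (s := insert (n k) (Finset.range m))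
    simp only [Finset.sum_insert hnm] at hsplit
    have e1 := hsplit _ hsum
    have e2 := hsplit _ (hx k)
    have e3 := hsplit _ hz
    rw [← mass_univ] at e2 e3
    have e4 : ∑ i ∈ Finset.range m, ‖x k i - y k i‖ ^ P =
        ∑ i ∈ Finset.range m, ‖x k i - z i‖ ^ P := Finset.sum_congr rfl fun i hi => by
      rw [hy1 k i (by have := Finset.mem_range.1 hi; omega)]
    have e5 := (hsum.subtype _).tsum_le_tsum (fun i : ((insert (n k) (Finset.range m) :
      Finset ℕ) : Set ℕ)ᶜ.Elem => hpt i i.2) (hsumr.subtype _)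
    have e6 : ∑' i : ((insert (n k) (Finset.range m) : Finset ℕ) : Set ℕ)ᶜ.Elem,
        2 ^ P * (‖x k i‖ ^ P + ‖z i‖ ^ P) =
        2 ^ P * (∑' i : ((insert (n k) (Finset.range m) : Finset ℕ) : Set ℕ)ᶜ.Elem, ‖x k i‖ ^ P +
          ∑' i : ((insert (n k) (Finset.range m) : Finset ℕ) : Set ℕ)ᶜ.Elem, ‖z i‖ ^ P) := by
      rw [tsum_mul_left]
      exact congrArg (2 ^ P * ·) (((hx k).subtype _).tsum_add (hz.subtype _))
    have hx1k := hx1 k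
    have e7 : 2 ^ P * (∑' i : ((insert (n k) (Finset.range m) : Finset ℕ) : Set ℕ)ᶜ.Elem,
          ‖x k i‖ ^ P + ∑' i : ((insert (n k) (Finset.range m) : Finset ℕ) : Set ℕ)ᶜ.Elem,
          ‖z i‖ ^ P) ≤ 2 ^ P * ((1 - ∑ i ∈ Finset.range m, ‖x k i‖ ^ P - ‖x k (n k)‖ ^ P) +
        (t - ∑ i ∈ Finset.range m, ‖z i‖ ^ P)) := by
      have : 0 ≤ ‖z (n k)‖ ^ P := by positivity
      gcongr <;> linarith
    rw [mass_univ]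
    rw [hy2, e4] at e1
    linarith
  · have h1 : Tendsto (fun k => ∑ i ∈ Finset.range m, ‖x k i - z i‖ ^ P) atTop (𝓝 0) := by
      have : Tendsto (fun k => ∑ i ∈ Finset.range m, ‖x k i - z i‖ ^ P) atTop
          (𝓝 (∑ i ∈ Finset.range m, ‖z i - z i‖ ^ P)) :=
        tendsto_finsetSum _ fun i _ => ((hcoord i).sub_const _).norm.rpow_const (Or.inr hP0.le)
      simpa [Real.zero_rpow hP0.ne'] using this
    have h2 : Tendsto (fun k => ‖x k (n k) - s‖ ^ P) atTop (𝓝 0) := by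
      have := (hns.sub_const (s : ℂ)).norm.rpow_const (p := P) (Or.inr hP0.le)
      simpa [Real.zero_rpow hP0.ne'] using this
    have h3 : Tendsto (fun k => ∑ i ∈ Finset.range m, ‖x k i‖ ^ P) atTop
        (𝓝 (∑ i ∈ Finset.range m, ‖z i‖ ^ P)) :=
      tendsto_finsetSum _ fun i _ => (hcoord i).norm.rpow_const (Or.inr hP0.le)
    have h4 : Tendsto (fun k => ‖x k (n k)‖ ^ P) atTop (𝓝 (s ^ P)) := by
      have := hns.norm.rpow_const (p := P) (Or.inr hP0.le)
      rwa [Complex.norm_real, Real.norm_of_nonneg hs.le] at this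
    have h5 := (h1.add h2).add ((((h3.const_sub 1).sub h4).add_const
      (t - ∑ i ∈ Finset.range m, ‖z i‖ ^ P)).const_mul (2 ^ P))
    convert h5 using 2
    rw [show s ^ P = 1 - t by linarith]; ring
  · simpa using ((hzlim.const_sub t).const_mul 2).const_mul (2 ^ P)

end limits

/-! ### The peaking functions belong to the ball algebra -/

section General

variable {X : Type*} [NormedAddCommGroup X] [NormedSpace ℂ X]

/-- The continuous extension of the restriction to the ball of a function that is continuous at a
boundary point has the expected value there. -/
theorem ext_eq_of_continuousAt {f : Au X} {F : X → ℂ}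
    (h : ∀ x : ball (0 : X) 1, (f : ball (0 : X) 1 →ᵇ ℂ) x = F x) (y : closedBall (0 : X) 1)
    (hF : ContinuousAt F y) : ext f y = F y :=
  ext_eq_of_tendsto ((hF.tendsto.comp tendsto_comap).congr fun x => (h x).symm)

theorem exists_Au_multilinear {N : ℕ} (T : ContinuousMultilinearMap ℂ (fun _ : Fin N => X) ℂ) :
    ∃ g : Au X, ∀ x : ball (0 : X) 1, (g : ball (0 : X) 1 →ᵇ ℂ) x = T fun _ => (x : X) := by
  refine exists_Au_eq (fun x : ball (0 : X) 1 => T fun _ => (x : X)) ?_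
    ⟨fun x => T fun _ => x, fun x _ => ?_, fun _ => rfl⟩
  · refine LipschitzWith.uniformContinuous (K := Real.toNNReal (‖T‖ * N)) ?_
    refine LipschitzWith.of_dist_le_mul fun x y => ?_
    rw [Real.coe_toNNReal _ (by positivity), dist_eq_norm, Subtype.dist_eq, dist_eq_norm]
    refine (T.norm_image_sub_le _ _).trans ?_
    have hconst : ∀ w : X, ‖w‖ ≤ 1 → ‖fun _ : Fin N => w‖ ≤ 1 := fun w hw =>
      (pi_norm_le_iff_of_nonneg zero_le_one).2 fun _ => hw
    have h1 := hconst x (mem_ball_zero_iff.1 x.2).le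
    have h2 := hconst y (mem_ball_zero_iff.1 y.2).le
    have h3 : ‖(fun _ : Fin N => (x : X)) - fun _ => (y : X)‖ ≤ ‖(x : X) - y‖ :=
      (pi_norm_le_iff_of_nonneg (norm_nonneg _)).2 fun _ => le_rfl
    rw [Fintype.card_fin]
    have h4 : max ‖fun _ : Fin N => (x : X)‖ ‖fun _ : Fin N => (y : X)‖ ^ (N - 1) ≤ 1 :=
      pow_le_one₀ (le_max_of_le_left (norm_nonneg _)) (max_le h1 h2)
    calc _ ≤ ‖T‖ * N * 1 * ‖(x : X) - y‖ := by gcongr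
      _ = _ := by rw [mul_one]
  · have h1 : AnalyticAt ℂ (fun x : X => ContinuousLinearMap.pi
        (fun _ : Fin N => ContinuousLinearMap.id ℂ X) x) x := ContinuousLinearMap.analyticAt _ x
    exact (T.analyticAt (x := fun _ => x)).fun_comp h1

theorem exists_Au_exp (L : X →L[ℂ] ℂ) (a b : ℂ) :
    ∃ g : Au X, ∀ x : ball (0 : X) 1,
      (g : ball (0 : X) 1 →ᵇ ℂ) x = Complex.exp (a * (L x - b)) := by
  refine exists_Au_eq (fun x : ball (0 : X) 1 => Complex.exp (a * (L x - b))) ?_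
    ⟨fun x => Complex.exp (a * (L x - b)), fun x _ => ?_, fun _ => rfl⟩
  · have h1 : UniformContinuousOn (fun w : ℂ => Complex.exp (a * (w - b))) (closedBall 0 ‖L‖) :=
      (isCompact_closedBall (0 : ℂ) ‖L‖).uniformContinuousOn_of_continuous (by fun_prop)
    have hmem : ∀ x : ball (0 : X) 1, L x ∈ closedBall (0 : ℂ) ‖L‖ := fun x =>
      mem_closedBall_zero_iff.2 ((L.le_opNorm x).trans
        (mul_le_of_le_one_right (norm_nonneg L) (mem_ball_zero_iff.1 x.2).le))
    have h2 : UniformContinuous fun x : ball (0 : X) 1 => L x :=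
      L.uniformContinuous.comp uniformContinuous_subtype_val
    simpa only [Function.comp_def, Set.domRestrict_apply] using
      (uniformContinuousOn_iff_restrict.1 h1).comp (h2.subtype_mk hmem)
  · have h1 : AnalyticAt ℂ (fun x : X => a * (L x - b)) x :=
      analyticAt_const.fun_mul ((L.analyticAt x).fun_sub analyticAt_const)
    exact h1.cexp

end General

section Lp

variable {p : ℝ≥0∞}

theorem summable_norm_rpow (hp : 0 < p.toReal) (x : lp (fun _ : ℕ => ℂ) p) :
    Summable fun n => ‖x n‖ ^ p.toReal := (lp.memℓp x).summable hp

theorem mass_univ_eq (hp : 0 < p.toReal) (x : lp (fun _ : ℕ => ℂ) p) :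
    mass p.toReal Set.univ x = ‖x‖ ^ p.toReal := by
  rw [mass_univ, lp.norm_rpow_eq_tsum hp]

/-- The `N`-linear form on `ℓ_p` that takes the product of the coordinates with index `n`. -/
noncomputable def coordinateForm (p : ℝ≥0∞) (N n : ℕ) :
    MultilinearMap ℂ (fun _ : Fin N => lp (fun _ : ℕ => ℂ) p) ℂ :=
  (MultilinearMap.mkPiAlgebra ℂ (Fin N) ℂ).compLinearMap fun _ =>
    lp.evalₗ (𝕜 := ℂ) (fun _ : ℕ => ℂ) p n

theorem coordinateForm_apply (N n : ℕ) (m : Fin N → lp (fun _ : ℕ => ℂ) p) :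
    coordinateForm p N n m = ∏ j, m j n := rfl

variable [Fact (1 ≤ p)]

/-- Hölder's inequality in a crude pointwise form: after normalization the product of the
coordinates is at most the `N`-th, hence the `p`-th, power of the largest one. -/
theorem norm_prod_le (hp : 0 < p.toReal) {N : ℕ} (hN : p.toReal < N)
    (m : Fin N → lp (fun _ : ℕ => ℂ) p) (n : ℕ) :
    ‖∏ j, m j n‖ ≤ (∏ j, ‖m j‖) * ∑ j, (‖m j n‖ ^ p.toReal / ‖m j‖ ^ p.toReal) := by
  have hp0 : p ≠ 0 := (ENNReal.toReal_pos_iff.1 hp).1.ne'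
  have hN0 : 0 < N := by
    have : (0 : ℝ) < N := hp.trans hN
    exact_mod_cast this
  by_cases h : ∃ j, m j = 0
  · obtain ⟨j, hj⟩ := h
    rw [Finset.prod_eq_zero (Finset.mem_univ j) (by rw [hj]; rfl), norm_zero]
    positivity
  push Not at h
  have hpos : ∀ j, 0 < ‖m j‖ := fun j => norm_pos_iff.2 (h j)
  have hne : (Finset.univ : Finset (Fin N)).Nonempty := ⟨⟨0, hN0⟩, Finset.mem_univ _⟩
  obtain ⟨i, -, hi⟩ := Finset.exists_max_image Finset.univ (fun j => ‖m j n‖ / ‖m j‖) hne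
  have hu0 : 0 ≤ ‖m i n‖ / ‖m i‖ := by positivity
  have hu1 : ‖m i n‖ / ‖m i‖ ≤ 1 :=
    (div_le_one (hpos i)).2 (lp.norm_apply_le_norm hp0 (m i) n)
  have h1 : ‖∏ j, m j n‖ = (∏ j, ‖m j‖) * ∏ j, (‖m j n‖ / ‖m j‖) := by
    rw [norm_prod, ← Finset.prod_mul_distrib]
    exact Finset.prod_congr rfl fun j _ => (mul_div_cancel₀ _ (hpos j).ne').symm
  rw [h1]
  refine mul_le_mul_of_nonneg_left ?_ (by positivity)
  calc ∏ j, (‖m j n‖ / ‖m j‖) ≤ ∏ _j : Fin N, (‖m i n‖ / ‖m i‖) :=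
        Finset.prod_le_prod (fun j _ => by positivity) fun j hj => hi j hj
    _ = (‖m i n‖ / ‖m i‖) ^ (N : ℝ) := by
        rw [Finset.prod_const, Finset.card_univ, Fintype.card_fin, Real.rpow_natCast]
    _ ≤ (‖m i n‖ / ‖m i‖) ^ p.toReal :=
        Real.rpow_le_rpow_of_exponent_ge' hu0 hu1 hp.le hN.le
    _ = ‖m i n‖ ^ p.toReal / ‖m i‖ ^ p.toReal := Real.div_rpow (norm_nonneg _) (norm_nonneg _) _
    _ ≤ ∑ j, (‖m j n‖ ^ p.toReal / ‖m j‖ ^ p.toReal) :=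
        Finset.single_le_sum (f := fun j => ‖m j n‖ ^ p.toReal / ‖m j‖ ^ p.toReal)
          (fun j _ => by positivity) (Finset.mem_univ i)

theorem summable_coordinateForm (hp : 0 < p.toReal) {N : ℕ} (hN : p.toReal < N)
    (m : Fin N → lp (fun _ : ℕ => ℂ) p) : Summable fun n => coordinateForm p N n m :=
  Summable.of_norm_bounded ((summable_sum fun j _ =>
    (summable_norm_rpow hp (m j)).div_const _).mul_left _) (norm_prod_le hp hN m)

theorem norm_tsum_coordinateForm_le (hp : 0 < p.toReal) {N : ℕ} (hN : p.toReal < N) (B : Set ℕ)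
    (m : Fin N → lp (fun _ : ℕ => ℂ) p) :
    ‖∑' n : B, coordinateForm p N n m‖ ≤ N * ∏ j, ‖m j‖ := by
  have hs : ∀ j, Summable fun n => ‖m j n‖ ^ p.toReal / ‖m j‖ ^ p.toReal :=
    fun j => (summable_norm_rpow hp (m j)).div_const _
  have hs' := fun j => (hs j).subtype B
  refine (tsum_of_norm_bounded ((summable_sum fun j _ => hs' j).mul_left _).hasSum
    fun n : B => norm_prod_le hp hN m n.1).trans ?_
  rw [tsum_mul_left, mul_comm]
  refine mul_le_mul_of_nonneg_right ?_ (by positivity)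
  refine (Summable.tsum_finsetSum fun j _ => hs' j).trans_le ?_
  have h1 : ∀ j, ∑' n : B, ‖m j n‖ ^ p.toReal / ‖m j‖ ^ p.toReal ≤ 1 := fun j => by
    rw [tsum_div_const]
    refine div_le_one_of_le₀ ?_ (by positivity)
    rw [← mass_univ_eq hp]
    exact mass_mono (summable_norm_rpow hp (m j)) (Set.subset_univ B)
  exact (Finset.sum_le_sum fun j _ => h1 j).trans_eq (by simp)

/-- The symmetric `N`-linear form `∑_{n ∈ B} m₁ n * ⋯ * m_N n` on `ℓ_p`, bounded for `N > p`. -/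
noncomputable def powerForm (hp : 0 < p.toReal) {N : ℕ} (hN : p.toReal < N) (B : Set ℕ) :
    ContinuousMultilinearMap ℂ (fun _ : Fin N => lp (fun _ : ℕ => ℂ) p) ℂ :=
  MultilinearMap.mkContinuous
    { toFun := fun m => ∑' n : B, coordinateForm p N n m
      map_update_add' := fun m i x y => by
        have hs := fun m => (summable_coordinateForm hp hN m).subtype B
        refine Eq.trans ?_ ((hs (Function.update m i x)).tsum_add (hs (Function.update m i y)))
        exact tsum_congr fun n => (coordinateForm p N n).map_update_add m i x y
      map_update_smul' := fun m i c x => by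
        rw [smul_eq_mul, ← tsum_mul_left]
        exact tsum_congr fun n => (coordinateForm p N n).map_update_smul m i c x }
    N (norm_tsum_coordinateForm_le hp hN B)

theorem powerForm_apply_const (hp : 0 < p.toReal) {N : ℕ} (hN : p.toReal < N) (B : Set ℕ)
    (x : lp (fun _ : ℕ => ℂ) p) : powerForm hp hN B (fun _ => x) = powerSum B N x := by
  refine tsum_congr fun n => ?_
  simp [coordinateForm_apply]

/-- The functional `∑_{i < k} dualCoeff P (z i) * x i` on `ℓ_p`. -/
noncomputable def dualFunctional (P : ℝ) (z : ℕ → ℂ) (k : ℕ) : lp (fun _ : ℕ => ℂ) p →L[ℂ] ℂ :=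
  ∑ i ∈ Finset.range k, dualCoeff P (z i) • lp.evalCLM ℂ (fun _ : ℕ => ℂ) p i

theorem dualFunctional_apply (P : ℝ) (z : ℕ → ℂ) (k : ℕ) (x : lp (fun _ : ℕ => ℂ) p) :
    dualFunctional P z k x = ∑ i ∈ Finset.range k, dualCoeff P (z i) * x i := by
  rw [dualFunctional, _root_.sum_apply]
  rfl

theorem continuous_peakFun (hp : 0 < p.toReal) {N : ℕ} (hN : p.toReal < N) (s t : ℝ) (z : ℕ → ℂ)
    (k : ℕ) (B : Set ℕ) :
    Continuous fun x : lp (fun _ : ℕ => ℂ) p => peakFun p.toReal s t z N k B x := by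
  have h1 : Continuous fun x : lp (fun _ : ℕ => ℂ) p => powerForm hp hN B fun _ => x :=
    (powerForm hp hN B).cont.comp (by fun_prop)
  have h2 := (dualFunctional (p := p) p.toReal z k).continuous
  simp only [powerForm_apply_const] at h1
  unfold peakFun
  simp only [← dualFunctional_apply]
  fun_prop

theorem exists_Au_peakFun (hp : 0 < p.toReal) {N : ℕ} (hN : p.toReal < N) (s t : ℝ) (z : ℕ → ℂ)
    (k : ℕ) (B : Set ℕ) :
    ∃ g : Au (lp (fun _ : ℕ => ℂ) p), ∀ y : closedBall (0 : lp (fun _ : ℕ => ℂ) p) 1,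
      ext g y = peakFun p.toReal s t z N k B (y : lp (fun _ : ℕ => ℂ) p) := by
  obtain ⟨g₁, hg₁⟩ := exists_Au_exp (dualFunctional (p := p) p.toReal z k)
    ((N / s ^ p.toReal : ℝ) : ℂ) t
  obtain ⟨g₂, hg₂⟩ := exists_Au_multilinear (powerForm hp hN B)
  have h1 : ∀ x, ((g₁ * (((s ^ N : ℝ) : ℂ)⁻¹ • g₂) : Au (lp (fun _ : ℕ => ℂ) p)) :
      ball (0 : lp (fun _ : ℕ => ℂ) p) 1 →ᵇ ℂ) x =
      (fun x : lp (fun _ : ℕ => ℂ) p => peakFun p.toReal s t z N k B x) x := fun x => by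
    rw [Subalgebra.coe_mul, Subalgebra.coe_smul, BoundedContinuousFunction.mul_apply,
      BoundedContinuousFunction.smul_apply, hg₁, hg₂, powerForm_apply_const,
      dualFunctional_apply, smul_eq_mul]
    simp only [peakFun]
  exact ⟨g₁ * (((s ^ N : ℝ) : ℂ)⁻¹ • g₂), fun y => ext_eq_of_continuousAt h1 y
    (continuous_peakFun hp hN s t z k B).continuousAt⟩

end Lp

/-! ### Gleason parts and functions of norm one -/

section General

variable {X : Type*} [NormedAddCommGroup X] [NormedSpace ℂ X]

theorem norm_sub_le_norm_one_sub_mul {r : ℝ} (hr0 : 0 ≤ r) (hr1 : r ≤ 1) {w : ℂ} (hw : ‖w‖ ≤ 1) :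
    ‖w - r‖ ≤ ‖1 - r * w‖ := by
  refine le_of_sq_le_sq ?_ (norm_nonneg _)
  have h1 : ‖w‖ ^ 2 = w.re * w.re + w.im * w.im := by
    rw [← Complex.normSq_eq_norm_sq, Complex.normSq_apply]
  have h2 : ‖w‖ ^ 2 ≤ 1 := pow_le_one₀ (norm_nonneg w) hw
  rw [h1] at h2
  rw [← Complex.normSq_eq_norm_sq, ← Complex.normSq_eq_norm_sq, Complex.normSq_apply,
    Complex.normSq_apply]
  simp only [Complex.sub_re, Complex.sub_im, Complex.ofReal_re, Complex.ofReal_im, Complex.one_re,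
    Complex.one_im, Complex.re_ofReal_mul, Complex.im_ofReal_mul]
  have h3 : 0 ≤ 1 - r ^ 2 := by nlinarith
  nlinarith [mul_nonneg h3 (sub_nonneg.2 h2)]

theorem one_sub_mul_ne_zero {r : ℝ} (hr0 : 0 ≤ r) (hr1 : r < 1) {w : ℂ} (hw : ‖w‖ ≤ 1) :
    1 - (r : ℂ) * w ≠ 0 := by
  intro h
  have h1 : ‖(r : ℂ) * w‖ = 1 := by rw [← sub_eq_zero.1 h, norm_one]
  rw [norm_mul, Complex.norm_real, Real.norm_of_nonneg hr0] at h1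
  nlinarith [norm_nonneg w]

/-- The disc automorphism `w ↦ (w - r) / (1 - r * w)` acts on the unit ball of the ball algebra. -/
theorem exists_Au_moebius {f : Au X} (hf : ‖f‖ ≤ 1) {r : ℝ} (hr0 : 0 ≤ r) (hr1 : r < 1) :
    ∃ h : Au X, ‖h‖ ≤ 1 ∧ h * (1 - (r : ℂ) • f) = f - (r : ℂ) • 1 := by
  have hfx : ∀ x, ‖(f : ball (0 : X) 1 →ᵇ ℂ) x‖ ≤ 1 := fun x =>
    ((f : ball (0 : X) 1 →ᵇ ℂ).norm_coe_le_norm x).trans hf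
  obtain ⟨huc, F, hF, hFf⟩ := f.2
  have hne : ∀ x, 1 - (r : ℂ) * (f : ball (0 : X) 1 →ᵇ ℂ) x ≠ 0 := fun x =>
    one_sub_mul_ne_zero hr0 hr1 (hfx x)
  obtain ⟨h, hh⟩ := exists_Au_eq
    (fun x => ((f : ball (0 : X) 1 →ᵇ ℂ) x - r) / (1 - r * (f : ball (0 : X) 1 →ᵇ ℂ) x)) (by
      have h1 : UniformContinuousOn (fun w : ℂ => (w - r) / (1 - r * w)) (closedBall 0 1) :=
        (isCompact_closedBall (0 : ℂ) 1).uniformContinuousOn_of_continuous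
          (ContinuousOn.div (by fun_prop) (by fun_prop) fun w hw =>
            one_sub_mul_ne_zero hr0 hr1 (mem_closedBall_zero_iff.1 hw))
      simpa only [Function.comp_def, Set.domRestrict_apply] using
        (uniformContinuousOn_iff_restrict.1 h1).comp
          (huc.subtype_mk fun x => mem_closedBall_zero_iff.2 (hfx x)))
    ⟨fun x => (F x - r) / (1 - r * F x), fun x hx => by
      have h1 := hF x hx
      refine (h1.fun_sub analyticAt_const).fun_div
        (analyticAt_const.fun_sub (analyticAt_const.fun_mul h1)) ?_
      have := hne ⟨x, hx⟩
      rwa [← hFf ⟨x, hx⟩] at this, fun x => by simp only [hFf]⟩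
  refine ⟨h, ?_, ?_⟩
  · refine (BoundedContinuousFunction.norm_le zero_le_one).2 fun x => ?_
    change ‖(h : ball (0 : X) 1 →ᵇ ℂ) x‖ ≤ 1
    rw [hh, norm_div]
    exact div_le_one_of_le₀ (norm_sub_le_norm_one_sub_mul hr0 hr1.le (hfx x)) (norm_nonneg _)
  · refine Subtype.ext (BoundedContinuousFunction.ext fun x => ?_)
    have h1 : ((h * (1 - (r : ℂ) • f) : Au X) : ball (0 : X) 1 →ᵇ ℂ) x =
      (h : ball (0 : X) 1 →ᵇ ℂ) x * (1 - r * (f : ball (0 : X) 1 →ᵇ ℂ) x) := rfl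
    have h2 : ((f - (r : ℂ) • 1 : Au X) : ball (0 : X) 1 →ᵇ ℂ) x =
      (f : ball (0 : X) 1 →ᵇ ℂ) x - r * 1 := rfl
    rw [h1, h2, hh, mul_one, div_mul_cancel₀ _ (hne x)]

theorem norm_apply_sub_le {φ ψ : Spectrum X} {h : Au X} (hh : ‖h‖ ≤ 1) :
    ‖φ h - ψ h‖ ≤ ‖CharacterSpace.toCLM φ - CharacterSpace.toCLM ψ‖ := by
  obtain ⟨L, hL⟩ : ∃ L : Au X →L[ℂ] ℂ, L = CharacterSpace.toCLM φ - CharacterSpace.toCLM ψ :=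
    ⟨_, rfl⟩
  have h1 : L h = φ h - ψ h := by rw [hL]; rfl
  rw [← hL, ← h1]
  exact (L.le_opNorm h).trans (mul_le_of_le_one_right (norm_nonneg L) hh)

theorem mem_gleasonPart_self (φ : Spectrum X) : φ ∈ gleasonPart φ := by
  refine lt_of_le_of_lt (ContinuousLinearMap.opNorm_le_bound _ le_rfl fun f => ?_) two_pos
  have h : (CharacterSpace.toCLM φ - CharacterSpace.toCLM φ) f = φ f - φ f := rfl
  rw [h, sub_self, norm_zero, zero_mul]

/-- Disc automorphisms push points away from a boundary point to nearly the opposite one, so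
elements of one Gleason part cannot be distinguished by functions of norm at most one that tend to
one under one of them. -/
theorem tendsto_one_of_mem_gleasonPart {φ ψ : Spectrum X} (h : ψ ∈ gleasonPart φ) {f : ℕ → Au X}
    (hf : ∀ k, ‖f k‖ ≤ 1) (hφ : Tendsto (fun k => φ (f k)) atTop (𝓝 1)) :
    Tendsto (fun k => ψ (f k)) atTop (𝓝 1) := by
  obtain ⟨c, hc⟩ : ∃ c, c = ‖CharacterSpace.toCLM φ - CharacterSpace.toCLM ψ‖ := ⟨_, rfl⟩
  have hc2 : c < 2 := by rw [hc]; exact h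
  have hc0 : 0 ≤ c := by
    rw [hc]; exact (norm_nonneg _).trans (norm_apply_sub_le (h := 0) (by simp))
  obtain ⟨c', hcc', hc'2⟩ := exists_between hc2
  rw [Metric.tendsto_nhds]
  intro ε hε
  -- For `r` close to one, `(w - r) / (1 - r * w)` is close to `-1` off a small disc about `1`.
  obtain ⟨r, hr0, hr1, hr⟩ : ∃ r : ℝ, 0 ≤ r ∧ r < 1 ∧ c' * (1 - r) < ε * (1 + r - c' * r) := by
    have h1 : Tendsto (fun r : ℝ => ε * (1 + r - c' * r) - c' * (1 - r)) (𝓝[<] 1)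
        (𝓝 (ε * (1 + 1 - c' * 1) - c' * (1 - 1))) :=
      (Continuous.tendsto (by fun_prop) 1).mono_left nhdsWithin_le_nhds
    have h2 := h1.eventually_const_lt (show 0 < ε * (1 + 1 - c' * 1) - c' * (1 - 1) by
      have : 0 < 2 - c' := by linarith
      nlinarith)
    obtain ⟨r, hr, hr'⟩ := (h2.and (Ico_mem_nhdsLT (show (0 : ℝ) < 1 by norm_num))).exists
    exact ⟨r, hr'.1, hr'.2, by linarith⟩
  choose m hm1 hm2 using fun k => exists_Au_moebius (hf k) hr0 hr1
  have hmul : ∀ (χ : Spectrum X) k, χ (m k) * (1 - r * χ (f k)) = χ (f k) - r := fun χ k => by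
    have := congrArg χ (hm2 k)
    rwa [map_mul, map_sub, map_sub, map_one, map_smul, map_smul, map_one, smul_eq_mul, smul_eq_mul,
      mul_one] at this
  have hlim : Tendsto (fun k => ‖1 - φ (m k)‖) atTop (𝓝 0) := by
    have hne : 1 - (r : ℂ) * 1 ≠ 0 := one_sub_mul_ne_zero hr0 hr1 (by simp)
    have hden : Tendsto (fun k => 1 - r * φ (f k)) atTop (𝓝 (1 - (r : ℂ) * 1)) :=
      (hφ.const_mul _).const_sub _
    have h1 := (hφ.sub_const (r : ℂ)).div hden hne
    have h2 : Tendsto (fun k => φ (m k)) atTop (𝓝 1) := by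
      rw [mul_one] at h1 hne
      rw [div_self hne] at h1
      refine h1.congr' ?_
      filter_upwards [hden.eventually_ne (by rwa [mul_one])] with k hk
      exact (eq_div_of_mul_eq hk (hmul φ k)).symm
    simpa using (h2.const_sub 1).norm
  filter_upwards [hlim.eventually_lt_const (sub_pos.2 hcc')] with k hk
  have h1 : ‖1 - ψ (m k)‖ ≤ c' := by
    have h2 := norm_apply_sub_le (φ := φ) (ψ := ψ) (hm1 k)
    have h3 := norm_add_le (1 - φ (m k)) (φ (m k) - ψ (m k))
    rw [sub_add_sub_cancel] at h3
    linarith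
  have h2 : ‖1 - ψ (f k)‖ * (1 + r) = ‖1 - ψ (m k)‖ * ‖1 - r * ψ (f k)‖ := by
    have h3 : (1 - ψ (f k)) * ((1 + r : ℝ) : ℂ) = (1 - ψ (m k)) * (1 - r * ψ (f k)) := by
      have h5 := hmul ψ k
      push_cast
      linear_combination h5
    rw [← norm_mul, ← h3, norm_mul, Complex.norm_real, Real.norm_of_nonneg (by linarith)]
  have h3 : ‖1 - r * ψ (f k)‖ ≤ r * ‖1 - ψ (f k)‖ + (1 - r) := by
    have h4 : 1 - r * ψ (f k) = r * (1 - ψ (f k)) + ((1 - r : ℝ) : ℂ) := by push_cast; ring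
    rw [h4]
    refine (norm_add_le _ _).trans_eq ?_
    rw [norm_mul, Complex.norm_real, Complex.norm_real, Real.norm_of_nonneg hr0,
      Real.norm_of_nonneg (by linarith)]
  rw [dist_comm, dist_eq_norm]
  have h4 : ‖1 - ψ (f k)‖ * (1 + r - c' * r) ≤ c' * (1 - r) := by
    have := mul_le_mul h1 h3 (norm_nonneg _) (by linarith)
    nlinarith
  have h5 : 0 < 1 + r - c' * r := by nlinarith
  exact lt_of_mul_lt_mul_right (h4.trans_lt hr) h5.le

theorem uniformContinuous_ext (f : Au X) : UniformContinuous (ext f) := by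
  rw [Metric.uniformContinuous_iff]
  intro ε hε
  obtain ⟨d, hd, h⟩ := Metric.uniformContinuous_iff.1 f.2.1 (ε / 2) (half_pos hε)
  refine ⟨d, hd, fun {x y} hxy => lt_of_le_of_lt ?_ (half_lt_self hε)⟩
  have := comap_neBot x
  have := comap_neBot y
  have hx : Tendsto ((↑) : ball (0 : X) 1 → X) _ (𝓝 (x : X)) := tendsto_comap
  have hy : Tendsto ((↑) : ball (0 : X) 1 → X) _ (𝓝 (y : X)) := tendsto_comap
  refine le_of_tendsto (((tendsto_ext f x).comp tendsto_fst).dist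
    ((tendsto_ext f y).comp tendsto_snd)) ?_
  filter_upwards [((hx.comp tendsto_fst).dist (hy.comp tendsto_snd)).eventually_lt_const hxy]
    with q hq
  exact (h hq).le

theorem continuous_apply_spectrum (f : Au X) : Continuous fun χ : Spectrum X => χ f :=
  (WeakDual.eval_continuous f).comp continuous_subtype_val

theorem delta_mem_closure (x : closedBall (0 : X) 1) :
    delta x ∈ closure (pointEvaluations X) := by
  have := comap_neBot x
  refine mem_closure_of_tendsto (b := comap ((↑) : ball (0 : X) 1 → X) (𝓝 (x : X)))
    (f := fun y : ball (0 : X) 1 => delta ⟨y, ball_subset_closedBall y.2⟩) ?_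
    (Eventually.of_forall fun y => ⟨y, y.2, rfl⟩)
  rw [tendsto_subtype_rng, tendsto_iff_forall_eval_tendsto_topDualPairing]
  intro f
  exact (tendsto_ext f x).congr fun y => (ext_eq f y).symm

theorem tendsto_dist_ext (f : Au X) {x y : ℕ → closedBall (0 : X) 1}
    (h : Tendsto (fun k => dist (x k : X) (y k)) atTop (𝓝 0)) :
    Tendsto (fun k => dist (ext f (x k)) (ext f (y k))) atTop (𝓝 0) := by
  rw [Metric.tendsto_nhds]
  intro η hη
  obtain ⟨d, hd, h2⟩ := Metric.uniformContinuous_iff.1 (uniformContinuous_ext f) η hη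
  filter_upwards [h.eventually_lt_const hd] with k hk
  rw [Real.dist_eq, sub_zero, abs_of_nonneg dist_nonneg]
  exact h2 hk

/-- Points of the ball can be chosen so that they represent a weak-star limit of point evaluations
simultaneously on finitely many sequences of functions. -/
theorem exists_ball_seq_tendsto {ι : Type*} [Finite ι] {ψ : Spectrum X}
    (hψ : ψ ∈ closure (pointEvaluations X)) (F : ι → ℕ → Au X) :
    ∃ x : ℕ → ball (0 : X) 1, ∀ i, Tendsto (fun k =>
      dist (ext (F i k) ⟨x k, ball_subset_closedBall (x k).2⟩) (ψ (F i k))) atTop (𝓝 0) := by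
  have happrox : ∀ k : ℕ, ∃ x : ball (0 : X) 1, ∀ i,
      dist (ext (F i k) ⟨x, ball_subset_closedBall x.2⟩) (ψ (F i k)) < 1 / ((k : ℝ) + 1) := by
    intro k
    have hev : ∀ᶠ χ in 𝓝 ψ, ∀ i, dist (χ (F i k)) (ψ (F i k)) < 1 / ((k : ℝ) + 1) :=
      eventually_all.2 fun i => Metric.tendsto_nhds.1
        ((continuous_apply_spectrum (F i k)).tendsto ψ) _ (by positivity)
    obtain ⟨χ, ⟨x, hx, rfl⟩, h⟩ := ((mem_closure_iff_frequently.1 hψ).and_eventually hev).exists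
    exact ⟨⟨x, hx⟩, h⟩
  choose x hx using happrox
  exact ⟨x, fun i => squeeze_zero (fun _ => dist_nonneg) (fun k => (hx k i).le)
    tendsto_one_div_add_atTop_nhds_zero_nat⟩

end General

/-! ### The peak homomorphisms -/

section Lp

variable {p : ℝ≥0∞}

theorem truncation_apply (n : ℕ) (z : lp (fun _ : ℕ => ℂ) p) (i : ℕ) :
    truncation n z i = if i < n then z i else 0 := by
  rw [truncation, lp.coeFn_sum, Finset.sum_apply]
  simp only [lp.single_apply, Pi.single_apply, Finset.sum_ite_eq, Finset.mem_range]

theorem peakVector_apply_of_lt (z : lp (fun _ : ℕ => ℂ) p) {n i : ℕ} (h : i < n) :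
    peakVector z n i = z i := by
  rw [peakVector, lp.coeFn_add, Pi.add_apply, truncation_apply, if_pos h,
    lp.single_apply_ne _ _ _ h.ne, add_zero]

theorem peakVector_apply_of_gt (z : lp (fun _ : ℕ => ℂ) p) {n i : ℕ} (h : n < i) :
    peakVector z n i = 0 := by
  rw [peakVector, lp.coeFn_add, Pi.add_apply, truncation_apply, if_neg h.not_gt,
    lp.single_apply_ne _ _ _ h.ne', add_zero]

theorem peakVector_apply_self (z : lp (fun _ : ℕ => ℂ) p) (n : ℕ) :
    peakVector z n n = (((1 - ‖z‖ ^ p.toReal) ^ (1 / p.toReal) : ℝ) : ℂ) := by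
  rw [peakVector, lp.coeFn_add, Pi.add_apply, truncation_apply, if_neg (lt_irrefl n),
    lp.single_apply_self, zero_add]

variable [Fact (1 ≤ p)]

theorem mass_univ_le_one (hp : 0 < p.toReal) {x : lp (fun _ : ℕ => ℂ) p} (hx : ‖x‖ ≤ 1) :
    mass p.toReal Set.univ x ≤ 1 := by
  rw [mass_univ_eq hp]; exact Real.rpow_le_one (norm_nonneg _) hx hp.le

end Lp

/-- On vectors that agree with `z` below an index `n ∈ A` and have value `s` at `n`, the peaking
functions are uniformly close to one. -/
theorem norm_peakFun_sub_one_le {P s t : ℝ} {z y : ℕ → ℂ} {N k n : ℕ} {A : Set ℕ} (hP1 : 1 < P)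
    (hs : 0 < s) (hst : s ^ P + t = 1) (hN : P < N)
    (hy : Summable fun n => ‖y n‖ ^ P) (hy1 : mass P Set.univ y ≤ 1) (hnA : n ∈ A) (hkn : k ≤ n)
    (hyz : ∀ i < n, y i = z i) (hyn : y n = s) :
    ‖peakFun P s t z N k (A ∩ Set.Ici k) y - 1‖ ≤
      |Real.exp (N / s ^ P * (∑ i ∈ Finset.range k, ‖z i‖ ^ P - t)) - 1| +
        Real.exp (N / s ^ P * (∑ i ∈ Finset.range k, ‖z i‖ ^ P - t)) *
          ((s ^ N)⁻¹ * (t - ∑ i ∈ Finset.range k, ‖z i‖ ^ P)) := by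
  have hP : 0 < P := by linarith
  have hsum : ∑ i ∈ Finset.range k, dualCoeff P (z i) * y i =
      ((∑ i ∈ Finset.range k, ‖z i‖ ^ P : ℝ) : ℂ) := by
    rw [Complex.ofReal_sum]
    refine Finset.sum_congr rfl fun i hi => ?_
    rw [hyz i (by have := Finset.mem_range.1 hi; omega), dualCoeff_mul_self hP1]
  have hsum2 : ∑ i ∈ Finset.range k, ‖y i‖ ^ P = ∑ i ∈ Finset.range k, ‖z i‖ ^ P :=
    Finset.sum_congr rfl fun i hi => by
      rw [hyz i (by have := Finset.mem_range.1 hi; omega)]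
  obtain ⟨Z, hZ⟩ : ∃ Z, Z = ∑ i ∈ Finset.range k, ‖z i‖ ^ P := ⟨_, rfl⟩
  rw [← hZ] at hsum hsum2 ⊢
  have hd : Disjoint ((Finset.range k : Finset ℕ) : Set ℕ) (A ∩ Set.Ici k) :=
    Set.disjoint_left.2 fun i hi hiB => by
      have := hiB.2
      simp at hi this; omega
  have h1 := (sum_add_mass_le hy hd).trans hy1
  have h2 := norm_powerSum_sub_le hP hy (norm_le_one_of_mass_le hP hy hy1) hN
    (show n ∈ A ∩ Set.Ici k from ⟨hnA, hkn⟩)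
  rw [hyn, Complex.norm_real, Real.norm_of_nonneg hs.le] at h2
  have h3 : ‖powerSum (A ∩ Set.Ici k) N y - (s : ℂ) ^ N‖ ≤ t - Z := by linarith
  obtain ⟨R, hR⟩ : ∃ R, R = powerSum (A ∩ Set.Ici k) N y - (s : ℂ) ^ N := ⟨_, rfl⟩
  have hsN : (s : ℂ) ^ N ≠ 0 := pow_ne_zero _ (by exact_mod_cast hs.ne')
  have h4 : peakFun P s t z N k (A ∩ Set.Ici k) y - 1 =
      ((Real.exp (N / s ^ P * (Z - t)) - 1 : ℝ) : ℂ) +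
        ((Real.exp (N / s ^ P * (Z - t)) : ℝ) : ℂ) * (((s ^ N)⁻¹ : ℝ) * R) := by
    rw [peakFun, hsum, show powerSum (A ∩ Set.Ici k) N y = (s : ℂ) ^ N + R by rw [hR]; ring]
    push_cast
    rw [mul_add, inv_mul_cancel₀ hsN]
    ring
  rw [h4]
  refine (norm_add_le _ _).trans ?_
  rw [norm_mul, norm_mul, Complex.norm_real, Complex.norm_real, Complex.norm_real,
    Real.norm_of_nonneg (Real.exp_pos _).le, Real.norm_of_nonneg (by positivity : 0 ≤ (s ^ N)⁻¹),
    Real.norm_eq_abs, hR]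
  gcongr

section Lp

variable {p : ℝ≥0∞} [Fact (1 ≤ p)]

/-- A sequence in the ball along which the peaking functions tend to one is asymptotic to a
sequence of the vectors `peakVector z n` with `n ∈ A`. -/
theorem exists_tendsto_dist_peakVector (hp : 1 < p.toReal) {z : lp (fun _ : ℕ => ℂ) p} {s : ℝ}
    (hs : 0 < s) (hst : s ^ p.toReal + ‖z‖ ^ p.toReal = 1)
    (hsz : s = (1 - ‖z‖ ^ p.toReal) ^ (1 / p.toReal)) {A : Set ℕ} {N : ℕ} (hN : p.toReal < N)
    {x : ℕ → lp (fun _ : ℕ => ℂ) p} (hx : ∀ k, ‖x k‖ ≤ 1)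
    (hF : Tendsto (fun k => peakFun p.toReal s (‖z‖ ^ p.toReal) z N k (A ∩ Set.Ici k) (x k))
      atTop (𝓝 1))
    (hF' : Tendsto (fun k => peakFun p.toReal s (‖z‖ ^ p.toReal) z (N + 1) k (A ∩ Set.Ici k) (x k))
      atTop (𝓝 1)) :
    ∃ n : ℕ → ℕ, (∀ᶠ k in atTop, n k ∈ A) ∧
      Tendsto (fun k => dist (x k) (peakVector z (n k))) atTop (𝓝 0) := by
  have hp0 : 0 < p.toReal := by linarith
  have hxs := fun k => summable_norm_rpow hp0 (x k)
  have hx1 := fun k => mass_univ_le_one hp0 (hx k)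
  have hz := summable_norm_rpow hp0 z
  have hzt := mass_univ_eq hp0 z
  obtain ⟨n, hn, hcoord, hns⟩ :=
    exists_tendsto_of_tendsto_peakFun hp hs hst hz hzt hxs hx1 hN hF hF'
  refine ⟨n, hn.mono fun k hk => hk.1, ?_⟩
  have h1 := tendsto_mass_sub (y := fun k i => peakVector z (n k) i) hp hs hst hz hzt hxs hx1
    (hn.mono fun k hk => hk.2) hcoord hns (fun k i hi => peakVector_apply_of_lt z hi)
    (fun k => by rw [hsz]; exact peakVector_apply_self z (n k))
    (fun k i hi => peakVector_apply_of_gt z hi)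
  refine tendsto_rpow_of_tendsto_rpow (fun k => dist_nonneg) le_rfl hp0 ?_
  rw [Real.zero_rpow hp0.ne']
  refine h1.congr fun k => ?_
  rw [dist_eq_norm, ← mass_univ_eq hp0]
  rfl

/-- If the peak homomorphisms converge to `φ` along a filter `U` that contains `A`, the values of
`φ` on the peaking functions with coordinates in `A` tend to one. -/
theorem tendsto_peakFun_of_tendsto (hp' : p ≠ ∞) (hp : 1 < p.toReal)
    {z : lp (fun _ : ℕ => ℂ) p} (hz : z ∈ ball (0 : lp (fun _ : ℕ => ℂ) p) 1) {s : ℝ}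
    (hs : 0 < s) (hst : s ^ p.toReal + ‖z‖ ^ p.toReal = 1)
    (hsz : s = (1 - ‖z‖ ^ p.toReal) ^ (1 / p.toReal)) {A : Set ℕ} {N : ℕ} (hN : p.toReal < N)
    {φ : Spectrum (lp (fun _ : ℕ => ℂ) p)} {U : Filter ℕ} [U.NeBot] (hU : U ≤ atTop) (hA : A ∈ U)
    (hφ : Tendsto (fun n => peakEvaluation hp' hz n) U (𝓝 φ))
    {g : ℕ → Au (lp (fun _ : ℕ => ℂ) p)}
    (hg : ∀ k y, ext (g k) y = peakFun p.toReal s (‖z‖ ^ p.toReal) z N k (A ∩ Set.Ici k)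
      (y : lp (fun _ : ℕ => ℂ) p)) :
    Tendsto (fun k => φ (g k)) atTop (𝓝 1) := by
  have hp0 : 0 < p.toReal := by linarith
  obtain ⟨Z, hZ⟩ : ∃ Z : ℕ → ℝ, ∀ k, Z k = ∑ i ∈ Finset.range k, ‖z i‖ ^ p.toReal :=
    ⟨_, fun _ => rfl⟩
  have hZt : Tendsto Z atTop (𝓝 (‖z‖ ^ p.toReal)) :=
    (tendsto_sum_range_rpow (summable_norm_rpow hp0 z) (mass_univ_eq hp0 z)).congr
      fun k => (hZ k).symm
  have hexp : Tendsto (fun k => Real.exp (N / s ^ p.toReal * (Z k - ‖z‖ ^ p.toReal))) atTop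
      (𝓝 1) := by
    have h1 := (Real.continuous_exp.tendsto _).comp
      ((hZt.sub_const (‖z‖ ^ p.toReal)).const_mul (N / s ^ p.toReal))
    simpa [Function.comp_def] using h1
  have hbound : Tendsto (fun k =>
      |Real.exp (N / s ^ p.toReal * (Z k - ‖z‖ ^ p.toReal)) - 1| +
        Real.exp (N / s ^ p.toReal * (Z k - ‖z‖ ^ p.toReal)) *
          ((s ^ N)⁻¹ * (‖z‖ ^ p.toReal - Z k))) atTop (𝓝 0) := by
    have h1 := (hexp.sub_const 1).abs.add
      (hexp.mul ((hZt.const_sub (‖z‖ ^ p.toReal)).const_mul (s ^ N)⁻¹))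
    simpa using h1
  rw [tendsto_iff_norm_sub_tendsto_zero]
  refine squeeze_zero (fun k => norm_nonneg _) (fun k => ?_) hbound
  refine le_of_tendsto ((((continuous_apply_spectrum (g k)).tendsto φ).comp hφ).sub_const 1).norm ?_
  filter_upwards [hA, hU (Ici_mem_atTop k)] with n hnA hkn
  have hy := peakVector_mem_closedBall hp' hz n
  have h1 : peakEvaluation hp' hz n (g k) = ext (g k) ⟨peakVector z n, hy⟩ := rfl
  rw [Function.comp_apply, h1, hg, hZ]
  exact norm_peakFun_sub_one_le hp hs hst hN (summable_norm_rpow hp0 _)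
    (mass_univ_le_one hp0 (mem_closedBall_zero_iff.1 hy)) hnA hkn
    (fun i hi => peakVector_apply_of_lt z hi) (by rw [hsz]; exact peakVector_apply_self z n)

theorem norm_le_one_of_ext_eq_peakFun (hp : 1 < p.toReal) {z : lp (fun _ : ℕ => ℂ) p} {s : ℝ}
    (hs : 0 < s) (hst : s ^ p.toReal + ‖z‖ ^ p.toReal = 1) {N k : ℕ} (hN : p.toReal < N)
    {B : Set ℕ} (hB : ∀ n ∈ B, k ≤ n) {g : Au (lp (fun _ : ℕ => ℂ) p)}
    (hg : ∀ y, ext g y = peakFun p.toReal s (‖z‖ ^ p.toReal) z N k B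
      (y : lp (fun _ : ℕ => ℂ) p)) : ‖g‖ ≤ 1 := by
  have hp0 : 0 < p.toReal := by linarith
  refine (BoundedContinuousFunction.norm_le zero_le_one).2 fun x => ?_
  change ‖(g : ball (0 : lp (fun _ : ℕ => ℂ) p) 1 →ᵇ ℂ) x‖ ≤ 1
  rw [← ext_eq, hg]
  exact norm_peakFun_le_one hp hs hst (summable_norm_rpow hp0 z) (mass_univ_eq hp0 z)
    (summable_norm_rpow hp0 _) (mass_univ_le_one hp0 (mem_ball_zero_iff.1 x.2).le) hB hN

/-- The peaking functions are elements of the ball algebra on which every element of the Gleason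
part of `φ` tends to one. -/
theorem exists_peaking_seq (hp' : p ≠ ∞) (hp : 1 < p.toReal)
    {z : lp (fun _ : ℕ => ℂ) p} (hz : z ∈ ball (0 : lp (fun _ : ℕ => ℂ) p) 1) {s : ℝ}
    (hs : 0 < s) (hst : s ^ p.toReal + ‖z‖ ^ p.toReal = 1)
    (hsz : s = (1 - ‖z‖ ^ p.toReal) ^ (1 / p.toReal)) {A : Set ℕ} {N : ℕ} (hN : p.toReal < N)
    {φ ψ : Spectrum (lp (fun _ : ℕ => ℂ) p)} {U : Filter ℕ} [U.NeBot] (hU : U ≤ atTop)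
    (hA : A ∈ U) (hφ : Tendsto (fun n => peakEvaluation hp' hz n) U (𝓝 φ))
    (hψ : ψ ∈ gleasonPart φ) :
    ∃ f : ℕ → Au (lp (fun _ : ℕ => ℂ) p),
      (∀ k y, ext (f k) y = peakFun p.toReal s (‖z‖ ^ p.toReal) z N k (A ∩ Set.Ici k)
        (y : lp (fun _ : ℕ => ℂ) p)) ∧ Tendsto (fun k => ψ (f k)) atTop (𝓝 1) := by
  have hp0 : 0 < p.toReal := by linarith
  choose f hf using fun k => exists_Au_peakFun (p := p) hp0 hN s (‖z‖ ^ p.toReal) z k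
    (A ∩ Set.Ici k)
  exact ⟨f, hf, tendsto_one_of_mem_gleasonPart hψ
    (fun k => norm_le_one_of_ext_eq_peakFun hp hs hst hN (fun n hn => hn.2) (hf k))
    (tendsto_peakFun_of_tendsto hp' hp hz hs hst hsz hN hU hA hφ hf)⟩

/-- If the peak homomorphisms converge to `φ` along a filter that contains `A`, and `ψ` in the
Gleason part of `φ` is a limit of point evaluations, then `ψ g` is the limit of a sequence of values
of `g` at vectors `peakVector z n` with `n ∈ A`. -/
theorem exists_seq_tendsto_ext_peakVector (hp' : p ≠ ∞) (hp : 1 < p.toReal)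
    {z : lp (fun _ : ℕ => ℂ) p} (hz : z ∈ ball (0 : lp (fun _ : ℕ => ℂ) p) 1) {A : Set ℕ}
    {φ ψ : Spectrum (lp (fun _ : ℕ => ℂ) p)} {U : Filter ℕ} [U.NeBot] (hU : U ≤ atTop)
    (hA : A ∈ U) (hφ : Tendsto (fun n => peakEvaluation hp' hz n) U (𝓝 φ))
    (hψ : ψ ∈ gleasonPart φ) (hψ' : ψ ∈ closure (pointEvaluations (lp (fun _ : ℕ => ℂ) p)))
    (g : Au (lp (fun _ : ℕ => ℂ) p)) :
    ∃ n : ℕ → ℕ, (∀ᶠ k in atTop, n k ∈ A) ∧ Tendsto (fun k =>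
      ext g ⟨peakVector z (n k), peakVector_mem_closedBall hp' hz (n k)⟩) atTop (𝓝 (ψ g)) := by
  have hp0 : 0 < p.toReal := by linarith
  have hz1 : ‖z‖ ^ p.toReal < 1 :=
    Real.rpow_lt_one (norm_nonneg _) (mem_ball_zero_iff.1 hz) hp0
  obtain ⟨s, hsz⟩ : ∃ s : ℝ, s = (1 - ‖z‖ ^ p.toReal) ^ (1 / p.toReal) := ⟨_, rfl⟩
  have hs : 0 < s := by rw [hsz]; exact Real.rpow_pos_of_pos (by linarith) _
  have hst : s ^ p.toReal + ‖z‖ ^ p.toReal = 1 := by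
    rw [hsz, one_div, Real.rpow_inv_rpow (by linarith) hp0.ne']; ring
  obtain ⟨N, hN⟩ := exists_nat_gt p.toReal
  have hN1 : p.toReal < (N + 1 : ℕ) := by push_cast; linarith
  obtain ⟨f, hf, hfψ⟩ := exists_peaking_seq hp' hp hz hs hst hsz hN hU hA hφ hψ
  obtain ⟨f', hf', hf'ψ⟩ := exists_peaking_seq hp' hp hz hs hst hsz hN1 hU hA hφ hψ
  obtain ⟨x, hx⟩ := exists_ball_seq_tendsto hψ' ![f, f', fun _ => g]
  have h0 : Tendsto (fun k => peakFun p.toReal s (‖z‖ ^ p.toReal) z N k (A ∩ Set.Ici k)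
      (x k : lp (fun _ : ℕ => ℂ) p)) atTop (𝓝 1) := by
    refine ((tendsto_iff_of_dist (hx 0)).2 hfψ).congr fun k => ?_
    exact hf k ⟨x k, ball_subset_closedBall (x k).2⟩
  have h1 : Tendsto (fun k => peakFun p.toReal s (‖z‖ ^ p.toReal) z (N + 1) k (A ∩ Set.Ici k)
      (x k : lp (fun _ : ℕ => ℂ) p)) atTop (𝓝 1) := by
    refine ((tendsto_iff_of_dist (hx 1)).2 hf'ψ).congr fun k => ?_
    exact hf' k ⟨x k, ball_subset_closedBall (x k).2⟩
  have h2 := (tendsto_iff_of_dist (hx 2)).2 (tendsto_const_nhds (x := ψ g))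
  obtain ⟨n, hnA, hdist⟩ := exists_tendsto_dist_peakVector hp hs hst hsz hN (A := A)
    (x := fun k => x k) (fun k => (mem_ball_zero_iff.1 (x k).2).le) h0 h1
  refine ⟨n, hnA, (tendsto_iff_of_dist ?_).1 h2⟩
  exact tendsto_dist_ext g (x := fun k => ⟨x k, ball_subset_closedBall (x k).2⟩)
    (y := fun k => ⟨peakVector z (n k), peakVector_mem_closedBall hp' hz (n k)⟩) hdist

/-- An element of the Gleason part of a cluster point `φ` of the peak homomorphisms that is a
limit of point evaluations agrees with `φ`. -/
theorem eq_of_mem_gleasonPart_of_mem_closure (hp' : p ≠ ∞) (hp : 1 < p.toReal)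
    {z : lp (fun _ : ℕ => ℂ) p} (hz : z ∈ ball (0 : lp (fun _ : ℕ => ℂ) p) 1)
    {φ ψ : Spectrum (lp (fun _ : ℕ => ℂ) p)}
    (hφ : MapClusterPt φ atTop (fun n : ℕ => peakEvaluation hp' hz n))
    (hψ : ψ ∈ gleasonPart φ) (hψ' : ψ ∈ closure (pointEvaluations (lp (fun _ : ℕ => ℂ) p))) :
    ψ = φ := by
  obtain ⟨U, hU, hUφ⟩ := mapClusterPt_iff_ultrafilter.1 hφ
  refine DFunLike.ext _ _ fun g => eq_of_forall_dist_le fun ε hε => ?_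
  have hUg : Tendsto (fun n => ext g ⟨peakVector z n, peakVector_mem_closedBall hp' hz n⟩)
      U (𝓝 (φ g)) := ((continuous_apply_spectrum g).tendsto φ).comp hUφ
  -- The peaking functions are built from the indices at which `g` is close to `φ g`.
  obtain ⟨n, hnA, hn⟩ := exists_seq_tendsto_ext_peakVector hp' hp hz hU
    (Metric.tendsto_nhds.1 hUg ε hε) hUφ hψ hψ' g
  refine le_of_tendsto (hn.dist tendsto_const_nhds) ?_
  filter_upwards [hnA] with k hk
  exact le_of_lt hk

end Lp

end BallAlgebra

theorem mainTheorem4 (p : ℝ≥0∞) [Fact (1 ≤ p)] (hp : 1 < p) (hp' : p ≠ ∞)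
    (z : lp (fun _ : ℕ => ℂ) p) (hz : z ∈ ball (0 : lp (fun _ : ℕ => ℂ) p) 1)
    (φ : BallAlgebra.Spectrum (lp (fun _ : ℕ => ℂ) p))
    (hφ : MapClusterPt φ atTop (fun n : ℕ => BallAlgebra.peakEvaluation hp' hz n)) :
    BallAlgebra.gleasonPart φ ∩ closure (BallAlgebra.pointEvaluations (lp (fun _ : ℕ => ℂ) p)) = {φ} ∧
      (BallAlgebra.corona (lp (fun _ : ℕ => ℂ) p) = ∅ → BallAlgebra.gleasonPart φ = {φ}) := by
  have hp1 : 1 < p.toReal := by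
    rw [← ENNReal.toReal_one]; exact (ENNReal.toReal_lt_toReal ENNReal.one_ne_top hp').2 hp
  have hinter : BallAlgebra.gleasonPart φ ∩
      closure (BallAlgebra.pointEvaluations (lp (fun _ : ℕ => ℂ) p)) = {φ} := by
    refine Set.Subset.antisymm
      (fun ψ hψ => BallAlgebra.eq_of_mem_gleasonPart_of_mem_closure hp' hp1 hz hφ hψ.1 hψ.2)
      (Set.singleton_subset_iff.2 ⟨?_, ?_⟩)
    · exact BallAlgebra.mem_gleasonPart_self φ
    · obtain ⟨U, -, hU⟩ := mapClusterPt_iff_ultrafilter.1 hφ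
      exact isClosed_closure.mem_of_tendsto hU
        (Eventually.of_forall fun n => BallAlgebra.delta_mem_closure _)
  refine ⟨hinter, fun hcorona => ?_⟩
  rw [BallAlgebra.corona, Set.compl_empty_iff] at hcorona
  rwa [hcorona, Set.inter_univ] at hinter
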